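/- \textbf{Setting.} Let $V$ be a complex inner product space with orthonormal basis $\psi_1,\dots,\psi_n$, $n=p+q$, and let $\Lambda^pV$ carry the Hermitian scalar product $\langle x_1\wedge\dots\wedge x_p|y_1\wedge\dots\wedge y_p\rangle=\det(\langle x_i|y_j\rangle)$ (conjugate-linear on the left). Indices $\mu,\mu'$ run over $1,\dots,p$ and $\nu,\nu'$ over $p+1,\dots,n$. Put $\Phi_0=\psi_1\wedge\dots\wedge\psi_p$; let $\Phi_\mu^\nu$ be $\Phi_0$ with $\psi_\mu$ replaced by $\psi_\nu$, and $\Phi_{\mu\mu'}^{\nu\nu'}$ ($\mu\ne\mu'$) be $\Phi_0$ with $\psi_\mu,\psi_{\mu'}$ replaced by $\psi_\nu,\psi_{\nu'}$. The HF manifold is the set of lines in $\mathbb P(\Lambda^pV)$ spanned by nonzero decomposable $p$-vectors. For real $(X,Y)\in\mathbb R^{pq}\times\mathbb R^{pq}$ write $Z_{\nu\mu}=X_{\nu\mu}+iY_{\nu\mu}$, $\mathbf Z=\sum_{\nu,\mu}(Z_{\nu\mu}|\psi_\nu\rangle\langle\psi_\mu|-\bar Z_{\nu\mu}|\psi_\mu\rangle\langle\psi_\nu|)$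 and $$\gamma^U(Z)=[\exp(\mathbf Z)\psi_1]\wedge\dots\wedge[\exp(\mathbf Z)\psi_p].$$ For a Hermitian operator $H$ on $\Lambda^pV$ put $E(Z)=\tfrac12\langle\gamma^U(Z)|H|\gamma^U(Z)\rangle$, $E_0=\langle\Phi_0|H|\Phi_0\rangle$, $H^{CIS}_{\nu\mu,\nu'\mu'}=\langle\Phi_\mu^\nu|H|\Phi_{\mu'}^{\nu'}\rangle$ and $\Delta_{\nu\mu,\nu'\mu'}=(1-\delta_{\nu\nu'})(1-\delta_{\mu\mu'})\langle\Phi_0|H|\Phi_{\mu\mu'}^{\nu\nu'}\rangle$. The parameter space $\mathbb R^{2pq}$ carries the symplectic form $\omega=\sum dX_{\nu\mu}\wedge dY_{\nu\mu}$, with matrix $\Omega=\begin{pmatrix}0&I\\-I&0\end{pmatrix}$, and the symplectic gradient $\xi$ of $E$ is defined by $\omega(u,\xi(w))=d_wE(u)$ for all $u,w$. \textbf{Theorem.} (0) $\gamma^U(0)=\Phi_0$; $\gamma^U(Z)$ is a unit vector whose line lies in the HF manifold, and $E(Z)$ is the value at that line of the function $[z]\mapsto\frac12\langle z|H|z\rangle/\langle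 z|z\rangle$. (1) For every Hermitian $H$, $E$ is real-valued and $C^\infty$, and $d_{0}E=0$ if and only if the Brillouin conditions $\langle\Phi_\mu^\nu|H|\Phi_0\rangle=0$ hold for all $\mu,\nu$. (2) $H^{CIS}$ is Hermitian, $\Delta$ is symmetric, and the Hessian of $E$ at the origin in the coordinates $(X,Y)$ is $$\mathscr H=\begin{pmatrix}\operatorname{Re}(H^{CIS}+\Delta)-E_0I&-\operatorname{Im}(H^{CIS}+\Delta)\\ \operatorname{Im}(H^{CIS}-\Delta)&\operatorname{Re}(H^{CIS}-\Delta)-E_0I\end{pmatrix}.$$ (3) The symplectic gradient $\xi$ of $E$ exists and is unique, $\xi(0)=0$ if and only if the Brillouin conditions hold, and its derivative at the origin is $-\Omega\mathscr H$; the linearized Hamiltonian equations are thus $\frac{d}{dt}\begin{pmatrix}X\\Y\end{pmatrix}=-\Omega\mathscr H\begin{pmatrix}X\\Y\end{pmatrix}$. (4) Let $S=i\begin{pmatrix}H^{CIS}-E_0I&\bar\Delta\\-\Delta&-(\bar H^{CIS}-E_0I)\end{pmatrix}$ and $C=\frac12\begin{pmatrix}I&I\\-iI&iI\end{pmatrix}$.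 Then $C$ is invertible and $-C^{-1}\Omega\mathscr H C=S$. Equivalently, if $a_{\nu\mu},s_{\nu\mu}$ are the coordinate vectors of $X_{\nu\mu},Y_{\nu\mu}$, the vectors $\frac12[1\otimes a_{\nu\mu}-i(1\otimes s_{\nu\mu})]$, $\frac12[1\otimes a_{\nu\mu}+i(1\otimes s_{\nu\mu})]$ form a basis of $\mathbb C\otimes_{\mathbb R}\mathbb R^{2pq}$, in which $1\otimes(X,Y)$ has coordinates $(Z,\bar Z)$ and the complexification of $-\Omega\mathscr H$ has matrix $S$. A curve $(X,Y)$ satisfies the linearized Hamiltonian equations at time $t$ if and only if $\frac{d}{dt}\begin{pmatrix}Z\\\bar Z\end{pmatrix}=S\begin{pmatrix}Z\\\bar Z\end{pmatrix}$ at $t$. (5) Let $h$ be a Hermitian operator on $V$ and $g$ a Hermitian operator on $V\otimes V$ commuting with the exchange of factors. Put $h_{ij}=\langle\psi_i|h|\psi_j\rangle$, $\langle ij|kl\rangle=\langle\psi_i\otimes\psi_j|g|\psi_k\otimes\psi_l\rangle$, $\langle ij\|kl\rangle=\langle ij|kl\rangle-\langle ij|lk\rangle$, and let $H=\sum h_{ij}a_i^\dagger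 a_j+\frac12\sum\langle ij|kl\rangle a_i^\dagger a_j^\dagger a_la_k$ on $\Lambda^pV$ be the electronic Hamiltonian. Then $H$ is Hermitian. If moreover the orbitals are canonical, i.e. $h_{ij}+\sum_{\mu}\langle i\mu\|j\mu\rangle=\varepsilon_i\delta_{ij}$ with real $\varepsilon_i$, then $$H^{CIS}_{\nu\mu,\nu'\mu'}=[E_0+\varepsilon_\nu-\varepsilon_\mu]\delta_{\mu\mu'}\delta_{\nu\nu'}+\langle\nu\mu'\|\mu\nu'\rangle,\qquad\Delta_{\nu\mu,\nu'\mu'}=\langle\mu\mu'\|\nu\nu'\rangle,$$ and the linearized Hamiltonian equations of this $H$ are equivalent to the TDHF equations $$\dot Z_{\nu\mu}=i\sum_{\nu'\mu'}[\langle\nu\mu'\|\mu\nu'\rangle+\delta_{\nu\nu'}\delta_{\mu\mu'}(\varepsilon_\nu-\varepsilon_\mu)]Z_{\nu'\mu'}+i\sum_{\nu'\mu'}\langle\nu\nu'\|\mu\mu'\rangle\bar Z_{\nu'\mu'},$$ $$\dot{\bar Z}_{\nu\mu}=-i\sum_{\nu'\mu'}[\langle\mu\nu'\|\nu\mu'\rangle+\delta_{\nu\nu'}\delta_{\mu\mu'}(\varepsilon_\nu-\varepsilon_\mu)]\bar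 Z_{\nu'\mu'}-i\sum_{\nu'\mu'}\langle\mu\mu'\|\nu\nu'\rangle Z_{\nu'\mu'}.$$ -/

import Mathlib

open scoped InnerProductSpace TensorProduct LinearAlgebra.Projectivization ContDiff Matrix

namespace HFManifold

noncomputable section

variable {p q : ℕ} {V : Type*} [NormedAddCommGroup V] [InnerProductSpace ℂ V]

/-! ### The space of `p`-electron states

`V` is the one-electron space, of dimension `n = p + q`, with an orthonormal basis `ψ` of molecular
spin orbitals; the first `p` of them are occupied, the last `q` are virtual.  The space of
`p`-electron states is the exterior power `⋀[ℂ]^p V`. -/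

/-- The decomposable `p`-vector (Slater determinant) `x₁ ∧ ⋯ ∧ x_p`. -/
def slater (x : Fin p → V) : ⋀[ℂ]^p V := exteriorPower.ιMulti ℂ p x

/-- The Hermitian scalar product `⟨x|y⟩` on the `p`-electron space, conjugate-linear in `x`: the one
for which the determinants `ψ_{i₁} ∧ ⋯ ∧ ψ_{i_p}`, `i₁ < ⋯ < i_p`, are orthonormal. -/
def pInner (ψ : OrthonormalBasis (Fin (p + q)) ℂ V) (x y : ⋀[ℂ]^p V) : ℂ :=
  ∑ s : Set.powersetCard (Fin (p + q)) p,
    starRingEnd ℂ ((ψ.toBasis.exteriorPower p).repr x s) * (ψ.toBasis.exteriorPower p).repr y s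

/-- The scalar product of two Slater determinants is the determinant of their overlap matrix; in
particular `pInner` does not depend on the orthonormal basis. -/
theorem pInner_slater (ψ : OrthonormalBasis (Fin (p + q)) ℂ V) (x y : Fin p → V) :
    pInner ψ (slater x) (slater y) = (Matrix.of fun i j => ⟪x i, y j⟫_ℂ).det := by
  classical
  let B := ψ.toBasis.exteriorPower p
  let L : ⋀[ℂ]^p V →ₗ[ℂ] ℂ :=
    ∑ s : Set.powersetCard (Fin (p + q)) p, starRingEnd ℂ (B.repr (slater x) s) • B.coord s
  let R : ⋀[ℂ]^p V →ₗ[ℂ] ℂ :=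
    exteriorPower.pairingDual ℂ V p
      (exteriorPower.ιMulti ℂ p fun j => (innerₛₗ ℂ (x j) : V →ₗ[ℂ] ℂ))
  have hL : ∀ z, L z = pInner ψ (slater x) z := by
    intro z
    simp [L, B, pInner, LinearMap.sum_apply]
  have hR : ∀ v : Fin p → V, R (slater v) = (Matrix.of fun i j => ⟪x i, v j⟫_ℂ).det := by
    intro v
    simp only [R, slater, exteriorPower.pairingDual_ιMulti_ιMulti]
    rw [← Matrix.det_transpose]
    congr 1
  have hLR : L = R := by
    refine B.ext fun s => ?_
    have hs : B s = slater (fun i => ψ (Set.powersetCard.ofFinEmbEquiv.symm s i)) := by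
      simp only [B, exteriorPower.basis_apply, exteriorPower.ιMulti_family, slater]
      congr 1
    have h1 : L (B s) = starRingEnd ℂ (B.repr (slater x) s) := by
      simp [L, Finsupp.single_apply]
    rw [h1, hs, hR]
    simp only [B, exteriorPower.basis_repr_apply, slater, exteriorPower.ιMultiDual_apply_ιMulti]
    rw [RingHom.map_det]
    congr 1
    ext i j
    simp [OrthonormalBasis.repr_apply_apply]
  rw [← hL, hLR, hR]

/-- `H` is a Hermitian operator on the `p`-electron space. -/
def IsHermitianOp (ψ : OrthonormalBasis (Fin (p + q)) ℂ V)
    (H : ⋀[ℂ]^p V →ₗ[ℂ] ⋀[ℂ]^p V) : Prop :=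
  ∀ x y, pInner ψ (H x) y = pInner ψ x (H y)

/-- The occupied orbitals `ψ_μ`, `μ = 1, …, p`. -/
def occ (ψ : OrthonormalBasis (Fin (p + q)) ℂ V) (μ : Fin p) : V := ψ (Fin.castAdd q μ)

/-- The virtual orbitals `ψ_ν`, `ν = p + 1, …, n`. -/
def virt (ψ : OrthonormalBasis (Fin (p + q)) ℂ V) (ν : Fin q) : V := ψ (Fin.natAdd p ν)

/-- `Φ₀ = ψ₁ ∧ ⋯ ∧ ψ_p`. -/
def Phi0 (ψ : OrthonormalBasis (Fin (p + q)) ℂ V) : ⋀[ℂ]^p V := slater (occ ψ)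

/-- `Φ_μ^ν`: the determinant `Φ₀` with `ψ_μ` replaced by `ψ_ν`; here `j = (ν, μ)`. -/
def PhiS (ψ : OrthonormalBasis (Fin (p + q)) ℂ V) (j : Fin q × Fin p) : ⋀[ℂ]^p V :=
  slater (Function.update (occ ψ) j.2 (virt ψ j.1))

/-- `Φ_{μμ'}^{νν'}`: the determinant `Φ₀` with `ψ_μ` replaced by `ψ_ν` and `ψ_μ'` by `ψ_ν'`
(used for `μ ≠ μ'`); here `j = (ν, μ)` and `j' = (ν', μ')`. -/
def PhiD (ψ : OrthonormalBasis (Fin (p + q)) ℂ V) (j j' : Fin q × Fin p) : ⋀[ℂ]^p V :=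
  slater (Function.update (Function.update (occ ψ) j.2 (virt ψ j.1)) j'.2 (virt ψ j'.1))

/-! ### The Hartree–Fock manifold and the energy -/

/-- The Hartree–Fock manifold: the lines of `p`-electron states spanned by the Slater determinants
of linearly independent one-electron vectors. -/
def HF (p : ℕ) (V : Type*) [NormedAddCommGroup V] [InnerProductSpace ℂ V] : Set (ℙ ℂ (⋀[ℂ]^p V)) :=
  {L | ∃ x : Fin p → V, LinearIndependent ℂ x ∧ L.submodule = Submodule.span ℂ {slater x}}

/-- The energy function `[z] ↦ ½ ⟨z|H|z⟩ / ⟨z|z⟩` on the projective space of `p`-electron states. -/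
def projEnergy (ψ : OrthonormalBasis (Fin (p + q)) ℂ V) (H : ⋀[ℂ]^p V →ₗ[ℂ] ⋀[ℂ]^p V)
    (L : ℙ ℂ (⋀[ℂ]^p V)) : ℝ :=
  (1 / 2) * ((pInner ψ L.rep (H L.rep)).re / (pInner ψ L.rep L.rep).re)

/-- Index set of the real coordinates: `Sum.inl (ν, μ)` is the index of `X_{νμ}` and
`Sum.inr (ν, μ)` that of `Y_{νμ}`. -/
abbrev Idx (p q : ℕ) : Type := (Fin q × Fin p) ⊕ (Fin q × Fin p)

/-- The real parameter space of dimension `2p(n-p)`, with coordinates `(X, Y)`. -/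
abbrev Param (p q : ℕ) : Type := Idx p q → ℝ

/-- `Z_{νμ} = X_{νμ} + i Y_{νμ}`. -/
def zCoord (w : Param p q) (j : Fin q × Fin p) : ℂ :=
  (w (Sum.inl j) : ℂ) + Complex.I * (w (Sum.inr j) : ℂ)

/-- The skew-Hermitian one-electron operator
`Z = ∑ (Z_{νμ} |ψ_ν⟩⟨ψ_μ| - conj Z_{νμ} |ψ_μ⟩⟨ψ_ν|)`. -/
def paramOp (ψ : OrthonormalBasis (Fin (p + q)) ℂ V) (w : Param p q) : V →L[ℂ] V :=
  ∑ j : Fin q × Fin p,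
    (zCoord w j • InnerProductSpace.rankOne ℂ (virt ψ j.1) (occ ψ j.2)
      - starRingEnd ℂ (zCoord w j) • InnerProductSpace.rankOne ℂ (occ ψ j.2) (virt ψ j.1))

/-- The unitary exponential parametrization
`γ^U(Z) = [exp(Z) ψ₁] ∧ ⋯ ∧ [exp(Z) ψ_p]`. -/
def gammaU (ψ : OrthonormalBasis (Fin (p + q)) ℂ V) (w : Param p q) : ⋀[ℂ]^p V :=
  slater fun μ => NormedSpace.exp (paramOp ψ w) (occ ψ μ)

/-- The energy `E(Z) = ½ ⟨γ^U(Z)|H|γ^U(Z)⟩` as a real function of the parameters. -/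
def energy (ψ : OrthonormalBasis (Fin (p + q)) ℂ V) (H : ⋀[ℂ]^p V →ₗ[ℂ] ⋀[ℂ]^p V)
    (w : Param p q) : ℝ :=
  (1 / 2) * (pInner ψ (gammaU ψ w) (H (gammaU ψ w))).re

/-- The Brillouin conditions `⟨Φ_μ^ν|H|Φ₀⟩ = 0`. -/
def Brillouin (ψ : OrthonormalBasis (Fin (p + q)) ℂ V) (H : ⋀[ℂ]^p V →ₗ[ℂ] ⋀[ℂ]^p V) : Prop :=
  ∀ j : Fin q × Fin p, pInner ψ (PhiS ψ j) (H (Phi0 ψ)) = 0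

/-! ### The matrices -/

/-- `E₀ = ⟨Φ₀|H|Φ₀⟩`. -/
def E0 (ψ : OrthonormalBasis (Fin (p + q)) ℂ V) (H : ⋀[ℂ]^p V →ₗ[ℂ] ⋀[ℂ]^p V) : ℝ :=
  (pInner ψ (Phi0 ψ) (H (Phi0 ψ))).re

/-- `H^CIS_{νμ,ν'μ'} = ⟨Φ_μ^ν|H|Φ_μ'^ν'⟩`. -/
def HCIS (ψ : OrthonormalBasis (Fin (p + q)) ℂ V) (H : ⋀[ℂ]^p V →ₗ[ℂ] ⋀[ℂ]^p V) :
    Matrix (Fin q × Fin p) (Fin q × Fin p) ℂ :=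
  Matrix.of fun j j' => pInner ψ (PhiS ψ j) (H (PhiS ψ j'))

/-- The constraining matrix
`Δ_{νμ,ν'μ'} = (1 - δ_{νν'}) (1 - δ_{μμ'}) ⟨Φ₀|H|Φ_{μμ'}^{νν'}⟩`. -/
def Delta (ψ : OrthonormalBasis (Fin (p + q)) ℂ V) (H : ⋀[ℂ]^p V →ₗ[ℂ] ⋀[ℂ]^p V) :
    Matrix (Fin q × Fin p) (Fin q × Fin p) ℂ :=
  Matrix.of fun j j' =>
    if j.1 = j'.1 ∨ j.2 = j'.2 then 0 else pInner ψ (Phi0 ψ) (H (PhiD ψ j j'))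

/-- The real matrix
`[[Re(H^CIS + Δ) - E₀, -Im(H^CIS + Δ)], [Im(H^CIS - Δ), Re(H^CIS - Δ) - E₀]]`. -/
def hess (ψ : OrthonormalBasis (Fin (p + q)) ℂ V) (H : ⋀[ℂ]^p V →ₗ[ℂ] ⋀[ℂ]^p V) :
    Matrix (Idx p q) (Idx p q) ℝ :=
  Matrix.fromBlocks
    ((HCIS ψ H + Delta ψ H).map Complex.re - E0 ψ H • (1 : Matrix _ _ ℝ))
    (-(HCIS ψ H + Delta ψ H).map Complex.im)
    ((HCIS ψ H - Delta ψ H).map Complex.im)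
    ((HCIS ψ H - Delta ψ H).map Complex.re - E0 ψ H • (1 : Matrix _ _ ℝ))

/-- `Ω = [[0, I], [-I, 0]]`. -/
def Om (p q : ℕ) : Matrix (Idx p q) (Idx p q) ℝ := Matrix.fromBlocks 0 1 (-1) 0

/-- `C = ½ [[I, I], [-i I, i I]]`. -/
def Cmat (p q : ℕ) : Matrix (Idx p q) (Idx p q) ℂ :=
  (1 / 2 : ℂ) • Matrix.fromBlocks 1 1 (-(Complex.I • (1 : Matrix _ _ ℂ)))
    (Complex.I • (1 : Matrix _ _ ℂ))

/-- The matrix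
`i [[H^CIS - E₀, conj Δ], [-Δ, -(conj H^CIS - E₀)]]` of the Schrödinger-type system. -/
def schr (ψ : OrthonormalBasis (Fin (p + q)) ℂ V) (H : ⋀[ℂ]^p V →ₗ[ℂ] ⋀[ℂ]^p V) :
    Matrix (Idx p q) (Idx p q) ℂ :=
  Complex.I • Matrix.fromBlocks
    (HCIS ψ H - (E0 ψ H : ℂ) • (1 : Matrix _ _ ℂ))
    ((Delta ψ H).map (starRingEnd ℂ))
    (-Delta ψ H)
    (-((HCIS ψ H).map (starRingEnd ℂ) - (E0 ψ H : ℂ) • (1 : Matrix _ _ ℂ)))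

/-! ### Symplectic structure and complexification of the parameter space -/

/-- The symplectic form `ω = ∑ dX_{νμ} ∧ dY_{νμ}` on the parameter space. -/
def omega (u v : Param p q) : ℝ :=
  ∑ j : Fin q × Fin p, (u (Sum.inl j) * v (Sum.inr j) - u (Sum.inr j) * v (Sum.inl j))

/-- `ξ` is the symplectic gradient (Hamiltonian vector field) of `f`:
`ω(u, ξ(w)) = d_w f(u)` for all `w` and `u`. -/
def IsSymplecticGradient (f : Param p q → ℝ) (ξ : Param p q → Param p q) : Prop :=
  ∀ w u, omega u (ξ w) = fderiv ℝ f w u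

/-- The vector `(Z, conj Z)`. -/
def zzbar (w : Param p q) : Idx p q → ℂ :=
  Sum.elim (zCoord w) fun j => starRingEnd ℂ (zCoord w j)

/-- The vectors `½ (1 ⊗ a_{νμ} - i (1 ⊗ s_{νμ}))` and `½ (1 ⊗ a_{νμ} + i (1 ⊗ s_{νμ}))` of the
complexified parameter space, where `a_{νμ}`, `s_{νμ}` are the coordinate vectors of the parameter
space belonging to `X_{νμ}`, `Y_{νμ}`. -/
def upsilon (p q : ℕ) : Idx p q → ℂ ⊗[ℝ] Param p q :=
  Sum.elim
    (fun j => (1 / 2 : ℂ) • ((1 : ℂ) ⊗ₜ[ℝ] (Pi.single (Sum.inl j) 1 : Param p q)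
      - Complex.I • ((1 : ℂ) ⊗ₜ[ℝ] (Pi.single (Sum.inr j) 1 : Param p q))))
    (fun j => (1 / 2 : ℂ) • ((1 : ℂ) ⊗ₜ[ℝ] (Pi.single (Sum.inl j) 1 : Param p q)
      + Complex.I • ((1 : ℂ) ⊗ₜ[ℝ] (Pi.single (Sum.inr j) 1 : Param p q))))

/-! ### The electronic Hamiltonian -/

/-- The creation operator of the orbital `ψ_i` on the Fock space. -/
def create (ψ : OrthonormalBasis (Fin (p + q)) ℂ V) (i : Fin (p + q)) :
    ExteriorAlgebra ℂ V →ₗ[ℂ] ExteriorAlgebra ℂ V :=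
  LinearMap.mulLeft ℂ (ExteriorAlgebra.ι ℂ (ψ i))

/-- The annihilation operator of the orbital `ψ_i` on the Fock space. -/
def annih (ψ : OrthonormalBasis (Fin (p + q)) ℂ V) (i : Fin (p + q)) :
    ExteriorAlgebra ℂ V →ₗ[ℂ] ExteriorAlgebra ℂ V :=
  CliffordAlgebra.contractLeft (ψ.toBasis.coord i)

/-- `h_{ij} = ⟨ψ_i|h|ψ_j⟩`. -/
def oneInt (ψ : OrthonormalBasis (Fin (p + q)) ℂ V) (h : V →ₗ[ℂ] V) (i j : Fin (p + q)) : ℂ :=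
  ⟪ψ i, h (ψ j)⟫_ℂ

/-- `⟨ij|kl⟩ = ⟨ψ_i ⊗ ψ_j|g|ψ_k ⊗ ψ_l⟩`. -/
def twoInt (ψ : OrthonormalBasis (Fin (p + q)) ℂ V) (g : V ⊗[ℂ] V →ₗ[ℂ] V ⊗[ℂ] V)
    (i j k l : Fin (p + q)) : ℂ :=
  ⟪ψ i ⊗ₜ[ℂ] ψ j, g (ψ k ⊗ₜ[ℂ] ψ l)⟫_ℂ

/-- `⟨ij‖kl⟩ = ⟨ij|kl⟩ - ⟨ij|lk⟩`. -/
def antiInt (ψ : OrthonormalBasis (Fin (p + q)) ℂ V) (g : V ⊗[ℂ] V →ₗ[ℂ] V ⊗[ℂ] V)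
    (i j k l : Fin (p + q)) : ℂ :=
  twoInt ψ g i j k l - twoInt ψ g i j l k

/-- The electronic Hamiltonian with one-electron part `h` and two-electron interaction `g` on the
Fock space: `∑ h_{ij} a†_i a_j + ½ ∑ ⟨ij|kl⟩ a†_i a†_j a_l a_k`. -/
def fockHam (ψ : OrthonormalBasis (Fin (p + q)) ℂ V) (h : V →ₗ[ℂ] V)
    (g : V ⊗[ℂ] V →ₗ[ℂ] V ⊗[ℂ] V) : ExteriorAlgebra ℂ V →ₗ[ℂ] ExteriorAlgebra ℂ V :=
  (∑ i, ∑ j, oneInt ψ h i j • (create ψ i ∘ₗ annih ψ j))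
    + (1 / 2 : ℂ) • ∑ i, ∑ j, ∑ k, ∑ l,
        twoInt ψ g i j k l • (create ψ i ∘ₗ create ψ j ∘ₗ annih ψ l ∘ₗ annih ψ k)

theorem create_mem (ψ : OrthonormalBasis (Fin (p + q)) ℂ V) (i : Fin (p + q)) (k : ℕ)
    {x : ExteriorAlgebra ℂ V} (hx : x ∈ ⋀[ℂ]^k V) : create ψ i x ∈ ⋀[ℂ]^(k + 1) V := by
  have : ⋀[ℂ]^(k + 1) V = ⋀[ℂ]^1 V * ⋀[ℂ]^k V := by
    simp only [ExteriorAlgebra.exteriorPower, pow_one]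
    rw [pow_succ']
  rw [this]
  exact Submodule.mul_mem_mul (by simp [ExteriorAlgebra.exteriorPower]) hx

theorem annih_zero (ψ : OrthonormalBasis (Fin (p + q)) ℂ V) (i : Fin (p + q))
    {x : ExteriorAlgebra ℂ V} (hx : x ∈ ⋀[ℂ]^0 V) : annih ψ i x = 0 := by
  have hx' : x ∈ (1 : Submodule ℂ (ExteriorAlgebra ℂ V)) := by
    simpa [ExteriorAlgebra.exteriorPower] using hx
  obtain ⟨r, rfl⟩ := Submodule.mem_one.1 hx'
  exact CliffordAlgebra.contractLeft_algebraMap _ _ r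

theorem annih_mem (ψ : OrthonormalBasis (Fin (p + q)) ℂ V) (i : Fin (p + q)) (k : ℕ) :
    ∀ {x : ExteriorAlgebra ℂ V}, x ∈ ⋀[ℂ]^(k + 1) V → annih ψ i x ∈ ⋀[ℂ]^k V := by
  induction k with
  | zero =>
    intro x hx
    have hx' : x ∈ LinearMap.range (ExteriorAlgebra.ι ℂ (M := V)) := by
      simpa [ExteriorAlgebra.exteriorPower] using hx
    obtain ⟨v, rfl⟩ := hx'
    have : annih ψ i (ExteriorAlgebra.ι ℂ v) = algebraMap ℂ _ (ψ.toBasis.coord i v) :=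
      CliffordAlgebra.contractLeft_ι _ _ v
    rw [this]
    simp [ExteriorAlgebra.exteriorPower]
  | succ k ih =>
    intro x hx
    have h1 : ⋀[ℂ]^(k + 1 + 1) V
        = LinearMap.range (ExteriorAlgebra.ι ℂ (M := V)) * ⋀[ℂ]^(k + 1) V := by
      simp only [ExteriorAlgebra.exteriorPower]
      rw [pow_succ']
    rw [h1] at hx
    refine Submodule.mul_induction_on hx ?_ ?_
    · rintro _ ⟨v, rfl⟩ y hy
      have h2 : annih ψ i (ExteriorAlgebra.ι ℂ v * y)
          = ψ.toBasis.coord i v • y - ExteriorAlgebra.ι ℂ v * annih ψ i y :=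
        CliffordAlgebra.contractLeft_ι_mul _ v y
      rw [h2]
      refine Submodule.sub_mem _ (Submodule.smul_mem _ _ hy) ?_
      have h3 : ⋀[ℂ]^(k + 1) V
          = LinearMap.range (ExteriorAlgebra.ι ℂ (M := V)) * ⋀[ℂ]^k V := by
        simp only [ExteriorAlgebra.exteriorPower]
        rw [pow_succ']
      rw [h3]
      exact Submodule.mul_mem_mul ⟨v, rfl⟩ (ih hy)
    · intro y z hy hz
      rw [map_add]
      exact Submodule.add_mem _ hy hz

theorem fockHam_mem (ψ : OrthonormalBasis (Fin (p + q)) ℂ V) (h : V →ₗ[ℂ] V)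
    (g : V ⊗[ℂ] V →ₗ[ℂ] V ⊗[ℂ] V) (k : ℕ) :
    ∀ x ∈ ⋀[ℂ]^k V, fockHam ψ h g x ∈ ⋀[ℂ]^k V := by
  intro x hx
  simp only [fockHam, LinearMap.add_apply, LinearMap.smul_apply, LinearMap.sum_apply,
    LinearMap.comp_apply]
  refine Submodule.add_mem _ ?_ (Submodule.smul_mem _ _ ?_)
  · refine Submodule.sum_mem _ fun i _ => Submodule.sum_mem _ fun j _ => Submodule.smul_mem _ _ ?_
    rcases k with _ | k
    · rw [annih_zero ψ j hx, map_zero]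
      exact Submodule.zero_mem _
    · exact create_mem ψ i k (annih_mem ψ j k hx)
  · refine Submodule.sum_mem _ fun i _ => Submodule.sum_mem _ fun j _ => Submodule.sum_mem _
      fun a _ => Submodule.sum_mem _ fun b _ => Submodule.smul_mem _ _ ?_
    rcases k with _ | _ | k
    · rw [annih_zero ψ a hx]
      simp only [map_zero]
      exact Submodule.zero_mem _
    · rw [annih_zero ψ b (annih_mem ψ a 0 hx)]
      simp only [map_zero]
      exact Submodule.zero_mem _
    · exact create_mem ψ i _ (create_mem ψ j _ (annih_mem ψ b _ (annih_mem ψ a _ hx)))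

/-- The electronic Hamiltonian on the `p`-electron space. -/
def elecHam (ψ : OrthonormalBasis (Fin (p + q)) ℂ V) (h : V →ₗ[ℂ] V)
    (g : V ⊗[ℂ] V →ₗ[ℂ] V ⊗[ℂ] V) : ⋀[ℂ]^p V →ₗ[ℂ] ⋀[ℂ]^p V :=
  (fockHam ψ h g).restrict (fockHam_mem ψ h g p)

/-- The Fock matrix `F_{ij} = h_{ij} + ∑_{μ ≤ p} ⟨iμ‖jμ⟩` of the determinant `Φ₀`. -/
def fockMat (ψ : OrthonormalBasis (Fin (p + q)) ℂ V) (h : V →ₗ[ℂ] V)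
    (g : V ⊗[ℂ] V →ₗ[ℂ] V ⊗[ℂ] V) : Matrix (Fin (p + q)) (Fin (p + q)) ℂ :=
  Matrix.of fun i j =>
    oneInt ψ h i j + ∑ μ : Fin p, antiInt ψ g i (Fin.castAdd q μ) j (Fin.castAdd q μ)

end

end HFManifold

open HFManifold

/-!
The exterior power `⋀[ℂ]^p V` carries the excitation operators `excit ψ i j = a†_i a_j`, the
derivations induced by the one-electron operators `|ψ_i⟩⟨ψ_j|`. They satisfy the commutation
relations of the matrix units of `𝔤𝔩ₙ` (`excit_mul_excit`), `a†_j a_i` is the adjoint of `a†_i a_j`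
(`pInner_excit_left`), and their action on `Φ₀` is explicit: `a†_ν a_μ Φ₀ = Φ_μ^ν`, `a_ν Φ₀ = 0` for
a virtual orbital and `a†_μ a_μ' Φ₀ = δ_{μμ'} Φ₀` for occupied ones. Everything is deduced from
these facts.

The derivation `genOp ψ u = ∑ (z a†_ν a_μ - conj z a†_μ a_ν)` generates the curve
`t ↦ γ^U(tu)`: the determinant of the vectors `exp(tU) ψ_μ` is differentiated by the Leibniz rule
in the finite-dimensional coordinates `coordP`. With `N = genOp ψ u` the energy along the line
therefore has first derivative `Re ⟨γ|H|Nγ⟩` and second derivative `Re (⟨γ|H|N²γ⟩ + ⟨Nγ|H|Nγ⟩)`. At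
the origin `NΦ₀ = ∑ z_j Φ_j` and `N²Φ₀ = ∑ z_j z_j' Φ_{jj'} - ∑ |z_j|² Φ₀`, which gives the
Brillouin conditions and the diagonal of the Hessian; as the energy is smooth, the Hessian is
symmetric and follows by polarization (`fderiv_fderiv_energy`). The symplectic gradient is `-Ω` applied to the
coordinate gradient, and the passage to `(Z, conj Z)` is conjugation by `Cmat`, whose inverse
`Dmat` is explicit.

For the electronic Hamiltonian, `½ ∑ ⟨ij|kl⟩ a†_i a†_j a_l a_k` is rewritten by excitation operators
(`elecHam_eq_coeffHam`). The matrices `H^CIS` and `Δ` are, up to the term `E₀`, expectation values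
in `Φ₀` of double commutators of `H` with excitation operators (`HCIS_coeffHam`, `Delta_coeffHam`).
Such a commutator is again a one- plus two-electron operator, whose coefficients are obtained by the
action of a matrix unit on tensors (`coeffHam_mul`), and the expectation value of any operator of
this kind in `Φ₀` is the usual Hartree–Fock sum (`pInner_Phi0_coeffHam`). This replaces the
case-by-case evaluation of matrix elements between excited determinants.
-/

namespace HFManifold

noncomputable section

variable {p q : ℕ} {V : Type*} [NormedAddCommGroup V] [InnerProductSpace ℂ V]

/-! ### Canonical anticommutation relations and excitation operators -/

theorem annih_create (ψ : OrthonormalBasis (Fin (p + q)) ℂ V) (i j : Fin (p + q))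
    (x : ExteriorAlgebra ℂ V) :
    annih ψ i (create ψ j x) = (if i = j then (1 : ℂ) else 0) • x - create ψ j (annih ψ i x) := by
  have h : annih ψ i (ExteriorAlgebra.ι ℂ (ψ j) * x) = ψ.toBasis.coord i (ψ j) • x
      - ExteriorAlgebra.ι ℂ (ψ j) * annih ψ i x := CliffordAlgebra.contractLeft_ι_mul _ _ _
  simp only [create, LinearMap.mulLeft_apply, h]
  congr 2
  simp

theorem create_create (ψ : OrthonormalBasis (Fin (p + q)) ℂ V) (i j : Fin (p + q))
    (x : ExteriorAlgebra ℂ V) : create ψ i (create ψ j x) = -create ψ j (create ψ i x) := by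
  simp only [create, LinearMap.mulLeft_apply, ← mul_assoc]
  rw [eq_neg_iff_add_eq_zero, ← add_mul, ExteriorAlgebra.ι_add_mul_swap, zero_mul]

theorem annih_annih (ψ : OrthonormalBasis (Fin (p + q)) ℂ V) (i j : Fin (p + q))
    (x : ExteriorAlgebra ℂ V) : annih ψ i (annih ψ j x) = -annih ψ j (annih ψ i x) :=
  CliffordAlgebra.contractLeft_comm _ _ _

theorem create_annih_mem (ψ : OrthonormalBasis (Fin (p + q)) ℂ V) (i j : Fin (p + q)) (k : ℕ) :
    ∀ x ∈ ⋀[ℂ]^k V, (create ψ i ∘ₗ annih ψ j) x ∈ ⋀[ℂ]^k V := by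
  intro x hx
  rw [LinearMap.comp_apply]
  rcases k with _ | k
  · rw [annih_zero ψ j hx, map_zero]
    exact Submodule.zero_mem _
  · exact create_mem ψ i k (annih_mem ψ j k hx)

/-- The excitation operator `a†_i a_j` on the `p`-electron space: the derivation induced by the
one-electron operator `|ψ_i⟩⟨ψ_j|`. -/
def excit (ψ : OrthonormalBasis (Fin (p + q)) ℂ V) (i j : Fin (p + q)) :
    Module.End ℂ (⋀[ℂ]^p V) :=
  (create ψ i ∘ₗ annih ψ j).restrict (create_annih_mem ψ i j p)

theorem coe_excit (ψ : OrthonormalBasis (Fin (p + q)) ℂ V) (i j : Fin (p + q)) (x : ⋀[ℂ]^p V) :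
    (excit ψ i j x : ExteriorAlgebra ℂ V) = create ψ i (annih ψ j x) := rfl

/-- The commutation relations `[a†_i a_j, a†_k a_l] = δ_{jk} a†_i a_l - δ_{li} a†_k a_j` of the
matrix units of `𝔤𝔩ₙ`. -/
theorem excit_mul_excit (ψ : OrthonormalBasis (Fin (p + q)) ℂ V) (i j k l : Fin (p + q)) :
    excit ψ i j * excit ψ k l = excit ψ k l * excit ψ i j
      + ((if j = k then (1 : ℂ) else 0) • excit ψ i l
        - (if l = i then (1 : ℂ) else 0) • excit ψ k j) := by
  refine LinearMap.ext fun x => Subtype.ext ?_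
  simp only [Module.End.mul_apply, LinearMap.add_apply, LinearMap.sub_apply, LinearMap.smul_apply,
    Submodule.coe_add, Submodule.coe_sub, Submodule.coe_smul, coe_excit, annih_create, map_sub,
    map_smul]
  rw [create_create ψ i k, annih_annih ψ j l]
  simp only [map_neg, neg_neg]
  abel

/-- The two-electron operators `a†_i a†_j a_l a_k` are expressed by excitation operators. -/
theorem coe_excit_mul_excit (ψ : OrthonormalBasis (Fin (p + q)) ℂ V) (i j k l : Fin (p + q))
    (x : ⋀[ℂ]^p V) :
    (((excit ψ i k * excit ψ j l - (if j = k then (1 : ℂ) else 0) • excit ψ i l :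
        Module.End ℂ (⋀[ℂ]^p V)) x : ⋀[ℂ]^p V) : ExteriorAlgebra ℂ V)
      = create ψ i (create ψ j (annih ψ l (annih ψ k x))) := by
  simp only [Module.End.mul_apply, LinearMap.sub_apply, LinearMap.smul_apply, Submodule.coe_sub,
    Submodule.coe_smul, coe_excit, annih_create, map_sub, map_smul]
  rw [annih_annih ψ l k]
  simp only [map_neg, eq_comm (a := k)]
  abel

/-- The operator `a†_i a_j` is a derivation of the exterior algebra. -/
theorem create_annih_ι_mul (ψ : OrthonormalBasis (Fin (p + q)) ℂ V) (i j : Fin (p + q)) (v : V)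
    (x : ExteriorAlgebra ℂ V) :
    create ψ i (annih ψ j (ExteriorAlgebra.ι ℂ v * x))
      = ExteriorAlgebra.ι ℂ (⟪ψ j, v⟫_ℂ • ψ i) * x
        + ExteriorAlgebra.ι ℂ v * create ψ i (annih ψ j x) := by
  have h : annih ψ j (ExteriorAlgebra.ι ℂ v * x) = ψ.toBasis.coord j v • x
      - ExteriorAlgebra.ι ℂ v * annih ψ j x := CliffordAlgebra.contractLeft_ι_mul _ _ _
  have h2 : ExteriorAlgebra.ι ℂ (ψ i) * ExteriorAlgebra.ι ℂ v
      = -(ExteriorAlgebra.ι ℂ v * ExteriorAlgebra.ι ℂ (ψ i)) := by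
    rw [eq_neg_iff_add_eq_zero, ExteriorAlgebra.ι_add_mul_swap]
  have h3 : ψ.toBasis.coord j v = ⟪ψ j, v⟫_ℂ := by
    simp [OrthonormalBasis.repr_apply_apply]
  rw [h, h3]
  simp only [create, LinearMap.mulLeft_apply, mul_sub, ← mul_assoc, h2, map_smul, mul_smul_comm,
    smul_mul_assoc, neg_mul, sub_neg_eq_add]

theorem create_annih_ιMulti (ψ : OrthonormalBasis (Fin (p + q)) ℂ V) (i j : Fin (p + q)) :
    ∀ (k : ℕ) (x : Fin k → V), create ψ i (annih ψ j (ExteriorAlgebra.ιMulti ℂ k x))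
      = ∑ m, ExteriorAlgebra.ιMulti ℂ k (Function.update x m (⟪ψ j, x m⟫_ℂ • ψ i)) := by
  intro k
  induction k with
  | zero =>
    intro x
    rw [annih_zero ψ j (ExteriorAlgebra.ιMulti_range ℂ 0 ⟨x, rfl⟩)]
    simp
  | succ k ih =>
    intro x
    rw [ExteriorAlgebra.ιMulti_succ_apply, create_annih_ι_mul, ih, Fin.sum_univ_succ,
      Finset.mul_sum]
    congr 1
    · rw [ExteriorAlgebra.ιMulti_succ_apply, Function.update_self]
      congr 2
    · refine Finset.sum_congr rfl fun m _ => ?_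
      rw [ExteriorAlgebra.ιMulti_succ_apply,
        Function.update_of_ne (Fin.succ_ne_zero m).symm]
      congr 2
      funext a
      simp only [Matrix.vecTail, Function.comp_apply, Function.update_apply, Fin.succ_inj]

/-- An excitation operator acts on a Slater determinant by the Leibniz rule. -/
theorem excit_slater (ψ : OrthonormalBasis (Fin (p + q)) ℂ V) (i j : Fin (p + q))
    (x : Fin p → V) :
    excit ψ i j (slater x) = ∑ m, slater (Function.update x m (⟪ψ j, x m⟫_ℂ • ψ i)) := by
  ext
  rw [coe_excit, slater, exteriorPower.ιMulti_apply_coe, create_annih_ιMulti]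
  simp [slater]

theorem slater_update_smul (x : Fin p → V) (m : Fin p) (c : ℂ) (v : V) :
    slater (Function.update x m (c • v)) = c • slater (Function.update x m v) :=
  (exteriorPower.ιMulti ℂ p).map_update_smul x m c v

/-! ### The scalar product of the `p`-electron space -/

/-- The coordinates of a `p`-electron state with respect to the determinants of orbitals, as a
vector of a Euclidean space. -/
def coordP (ψ : OrthonormalBasis (Fin (p + q)) ℂ V) :
    ⋀[ℂ]^p V ≃ₗ[ℂ] EuclideanSpace ℂ (Set.powersetCard (Fin (p + q)) p) :=
  (ψ.toBasis.exteriorPower p).equivFun.trans (WithLp.linearEquiv 2 ℂ _).symm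

theorem pInner_eq_inner (ψ : OrthonormalBasis (Fin (p + q)) ℂ V) (x y : ⋀[ℂ]^p V) :
    pInner ψ x y = ⟪coordP ψ x, coordP ψ y⟫_ℂ := by
  rw [PiLp.inner_apply]
  exact Finset.sum_congr rfl fun s _ => mul_comm _ _

theorem pInner_conj (ψ : OrthonormalBasis (Fin (p + q)) ℂ V) (x y : ⋀[ℂ]^p V) :
    starRingEnd ℂ (pInner ψ x y) = pInner ψ y x := by
  simp only [pInner_eq_inner, inner_conj_symm]

theorem pInner_add_left (ψ : OrthonormalBasis (Fin (p + q)) ℂ V) (x y z : ⋀[ℂ]^p V) :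
    pInner ψ (x + y) z = pInner ψ x z + pInner ψ y z := by
  simp only [pInner_eq_inner, map_add, inner_add_left]

theorem pInner_add_right (ψ : OrthonormalBasis (Fin (p + q)) ℂ V) (x y z : ⋀[ℂ]^p V) :
    pInner ψ x (y + z) = pInner ψ x y + pInner ψ x z := by
  simp only [pInner_eq_inner, map_add, inner_add_right]

theorem pInner_sub_left (ψ : OrthonormalBasis (Fin (p + q)) ℂ V) (x y z : ⋀[ℂ]^p V) :
    pInner ψ (x - y) z = pInner ψ x z - pInner ψ y z := by
  simp only [pInner_eq_inner, map_sub, inner_sub_left]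

theorem pInner_sub_right (ψ : OrthonormalBasis (Fin (p + q)) ℂ V) (x y z : ⋀[ℂ]^p V) :
    pInner ψ x (y - z) = pInner ψ x y - pInner ψ x z := by
  simp only [pInner_eq_inner, map_sub, inner_sub_right]

theorem pInner_smul_left (ψ : OrthonormalBasis (Fin (p + q)) ℂ V) (c : ℂ) (x y : ⋀[ℂ]^p V) :
    pInner ψ (c • x) y = starRingEnd ℂ c * pInner ψ x y := by
  simp only [pInner_eq_inner, map_smul, inner_smul_left]

theorem pInner_smul_right (ψ : OrthonormalBasis (Fin (p + q)) ℂ V) (c : ℂ) (x y : ⋀[ℂ]^p V) :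
    pInner ψ x (c • y) = c * pInner ψ x y := by
  simp only [pInner_eq_inner, map_smul, inner_smul_right]

theorem pInner_sum_left (ψ : OrthonormalBasis (Fin (p + q)) ℂ V) {ι : Type*} (s : Finset ι)
    (f : ι → ⋀[ℂ]^p V) (y : ⋀[ℂ]^p V) :
    pInner ψ (∑ i ∈ s, f i) y = ∑ i ∈ s, pInner ψ (f i) y := by
  simp only [pInner_eq_inner, map_sum, sum_inner]

theorem pInner_sum_right (ψ : OrthonormalBasis (Fin (p + q)) ℂ V) {ι : Type*} (s : Finset ι)
    (f : ι → ⋀[ℂ]^p V) (x : ⋀[ℂ]^p V) :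
    pInner ψ x (∑ i ∈ s, f i) = ∑ i ∈ s, pInner ψ x (f i) := by
  simp only [pInner_eq_inner, map_sum, inner_sum]

theorem pInner_zero_left (ψ : OrthonormalBasis (Fin (p + q)) ℂ V) (x : ⋀[ℂ]^p V) :
    pInner ψ 0 x = 0 := by
  simp only [pInner_eq_inner, map_zero, inner_zero_left]

theorem pInner_zero_right (ψ : OrthonormalBasis (Fin (p + q)) ℂ V) (x : ⋀[ℂ]^p V) :
    pInner ψ x 0 = 0 := by
  simp only [pInner_eq_inner, map_zero, inner_zero_right]

/-- Slater determinants span the `p`-electron space, so a linear condition need only be checked on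
them. -/
theorem slater_induction {P : ⋀[ℂ]^p V → Prop} (hs : ∀ x, P (slater x)) (h0 : P 0)
    (hadd : ∀ x y, P x → P y → P (x + y)) (hsmul : ∀ (c : ℂ) x, P x → P (c • x))
    (x : ⋀[ℂ]^p V) : P x := by
  have hx : x ∈ Submodule.span ℂ (Set.range (exteriorPower.ιMulti ℂ p (M := V))) := by
    rw [exteriorPower.ιMulti_span]
    exact Submodule.mem_top
  induction hx using Submodule.span_induction with
  | mem x h => obtain ⟨v, rfl⟩ := h; exact hs v
  | zero => exact h0
  | add x y _ _ hx hy => exact hadd x y hx hy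
  | smul c x _ hx => exact hsmul c x hx

/-- `a†_j a_i` is the adjoint of `a†_i a_j`. On determinants both sides are the derivative of the
overlap determinant in the direction of a matrix of rank one, expanded by rows and by columns. -/
theorem pInner_excit_left (ψ : OrthonormalBasis (Fin (p + q)) ℂ V) (i j : Fin (p + q))
    (x y : ⋀[ℂ]^p V) : pInner ψ (excit ψ i j x) y = pInner ψ x (excit ψ j i y) := by
  induction x using slater_induction with
  | h0 => simp only [map_zero, pInner_zero_left]
  | hadd x x' hx hx' => simp only [map_add, pInner_add_left, hx, hx']
  | hsmul c x hx => simp only [map_smul, pInner_smul_left, hx]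
  | hs x =>
    induction y using slater_induction with
    | h0 => simp only [map_zero, pInner_zero_right]
    | hadd y y' hy hy' => simp only [map_add, pInner_add_right, hy, hy']
    | hsmul c y hy => simp only [map_smul, pInner_smul_right, hy]
    | hs y =>
      set G : Matrix (Fin p) (Fin p) ℂ := Matrix.of fun a b => ⟪x a, y b⟫_ℂ with hG
      set c : Fin p → ℂ := fun a => ⟪x a, ψ j⟫_ℂ with hc
      set d : Fin p → ℂ := fun b => ⟪ψ i, y b⟫_ℂ with hd
      have hL : ∀ m, pInner ψ (slater (Function.update x m (⟪ψ j, x m⟫_ℂ • ψ i))) (slater y)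
          = c m * Gᵀ.cramer d m := by
        intro m
        rw [slater_update_smul, pInner_smul_left, pInner_slater, Matrix.cramer_transpose_apply,
          inner_conj_symm]
        congr 2
        ext a b
        rcases eq_or_ne a m with rfl | h
        · simp [hd]
        · simp [hG, h]
      have hR : ∀ m, pInner ψ (slater x) (slater (Function.update y m (⟪ψ i, y m⟫_ℂ • ψ j)))
          = d m * G.cramer c m := by
        intro m
        rw [slater_update_smul, pInner_smul_right, pInner_slater, Matrix.cramer_apply]
        congr 2
        ext a b
        rcases eq_or_ne b m with rfl | h
        · simp [hc]
        · simp [hG, h]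
      rw [excit_slater, excit_slater, pInner_sum_left, pInner_sum_right,
        Finset.sum_congr rfl fun m _ => hL m, Finset.sum_congr rfl fun m _ => hR m]
      change c ⬝ᵥ Gᵀ.cramer d = d ⬝ᵥ G.cramer c
      rw [Matrix.cramer_eq_adjugate_mulVec, Matrix.cramer_eq_adjugate_mulVec,
        ← Matrix.adjugate_transpose, Matrix.mulVec_transpose, dotProduct_comm,
        Matrix.dotProduct_mulVec]

/-! ### Excitations of the reference determinant -/

theorem castAdd_ne_natAdd (μ : Fin p) (ν : Fin q) : Fin.castAdd q μ ≠ Fin.natAdd p ν := by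
  intro h
  have := congrArg Fin.val h
  simp only [Fin.val_castAdd, Fin.val_natAdd] at this
  omega

theorem inner_basis (ψ : OrthonormalBasis (Fin (p + q)) ℂ V) (i j : Fin (p + q)) :
    ⟪ψ i, ψ j⟫_ℂ = if i = j then 1 else 0 :=
  orthonormal_iff_ite.mp ψ.orthonormal i j

theorem slater_eq_zero_of_eq (x : Fin p → V) {a b : Fin p} (h : x a = x b) (hab : a ≠ b) :
    slater x = 0 :=
  (exteriorPower.ιMulti ℂ p).map_eq_zero_of_eq x h hab

theorem excit_virt_Phi0 (ψ : OrthonormalBasis (Fin (p + q)) ℂ V) (i : Fin (p + q)) (ν : Fin q) :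
    excit ψ i (Fin.natAdd p ν) (Phi0 ψ) = 0 := by
  rw [Phi0, excit_slater]
  refine Finset.sum_eq_zero fun m _ => ?_
  rw [slater_update_smul, occ, inner_basis, if_neg (castAdd_ne_natAdd _ _).symm, zero_smul]

theorem excit_occ_Phi0 (ψ : OrthonormalBasis (Fin (p + q)) ℂ V) (i : Fin (p + q)) (μ : Fin p) :
    excit ψ i (Fin.castAdd q μ) (Phi0 ψ) = slater (Function.update (occ ψ) μ (ψ i)) := by
  rw [Phi0, excit_slater, Finset.sum_eq_single μ]
  · rw [slater_update_smul, occ, inner_basis, if_pos rfl, one_smul]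
  · intro m _ hm
    rw [slater_update_smul, occ, inner_basis,
      if_neg fun h => hm (Fin.castAdd_injective p q h).symm, zero_smul]
  · simp

theorem excit_occ_occ_Phi0 (ψ : OrthonormalBasis (Fin (p + q)) ℂ V) (μ μ' : Fin p) :
    excit ψ (Fin.castAdd q μ) (Fin.castAdd q μ') (Phi0 ψ)
      = (if μ = μ' then (1 : ℂ) else 0) • Phi0 ψ := by
  rw [excit_occ_Phi0]
  split_ifs with h
  · subst h
    rw [one_smul, ← occ, Function.update_eq_self, Phi0]
  · rw [zero_smul]
    refine slater_eq_zero_of_eq _ (a := μ) (b := μ') ?_ h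
    rw [Function.update_self, Function.update_of_ne h, occ]

theorem excit_virt_occ_Phi0 (ψ : OrthonormalBasis (Fin (p + q)) ℂ V) (ν : Fin q) (μ : Fin p) :
    excit ψ (Fin.natAdd p ν) (Fin.castAdd q μ) (Phi0 ψ) = PhiS ψ (ν, μ) := by
  rw [excit_occ_Phi0]
  rfl

/-- A second excitation of `Φ_μ^ν` gives a doubly excited determinant, or zero if it acts on the
orbital `ψ_μ` that is no longer occupied or leads to the orbital `ψ_ν` that already is. -/
theorem excit_virt_occ_PhiS (ψ : OrthonormalBasis (Fin (p + q)) ℂ V) (j j' : Fin q × Fin p) :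
    excit ψ (Fin.natAdd p j'.1) (Fin.castAdd q j'.2) (PhiS ψ j)
      = if j.1 = j'.1 ∨ j.2 = j'.2 then 0 else PhiD ψ j j' := by
  rw [PhiS, excit_slater]
  have hz : ∀ m, m ≠ j'.2 ∨ m = j.2 → slater (Function.update
      (Function.update (occ ψ) j.2 (virt ψ j.1)) m
      (⟪ψ (Fin.castAdd q j'.2), Function.update (occ ψ) j.2 (virt ψ j.1) m⟫_ℂ
        • ψ (Fin.natAdd p j'.1))) = 0 := by
    intro m hm
    rw [slater_update_smul]
    rcases eq_or_ne m j.2 with rfl | h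
    · rw [Function.update_self, virt, inner_basis, if_neg (castAdd_ne_natAdd _ _), zero_smul]
    · rw [Function.update_of_ne h, occ, inner_basis,
        if_neg fun h' => (hm.resolve_right h) (Fin.castAdd_injective p q h').symm, zero_smul]
  rcases eq_or_ne j.2 j'.2 with h | h
  · rw [if_pos (Or.inr h)]
    exact Finset.sum_eq_zero fun m _ => hz m (by rw [h]; exact ne_or_eq _ _)
  · rw [Finset.sum_eq_single j'.2 (fun m _ hm => hz m (Or.inl hm)) (by simp),
      slater_update_smul, Function.update_of_ne h.symm, occ, inner_basis, if_pos rfl, one_smul]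
    split_ifs with h1
    · refine slater_eq_zero_of_eq _ (a := j.2) (b := j'.2) ?_ h
      rw [Function.update_of_ne h, Function.update_self, Function.update_self, virt,
        h1.resolve_right h]
    · rfl

/-- De-excitation of `Φ_μ^ν`; from the commutation relations, since de-excitations annihilate
`Φ₀`. -/
theorem excit_occ_virt_PhiS (ψ : OrthonormalBasis (Fin (p + q)) ℂ V) (j j' : Fin q × Fin p) :
    excit ψ (Fin.castAdd q j'.2) (Fin.natAdd p j'.1) (PhiS ψ j)
      = (if j = j' then (1 : ℂ) else 0) • Phi0 ψ := by
  rw [← Prod.mk.eta (p := j), ← excit_virt_occ_Phi0, ← Module.End.mul_apply, excit_mul_excit]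
  simp only [LinearMap.add_apply, LinearMap.sub_apply, LinearMap.smul_apply,
    Module.End.mul_apply, excit_virt_Phi0, excit_occ_occ_Phi0, map_zero, smul_zero, zero_add,
    sub_zero, smul_smul, (Fin.natAdd_injective q p).eq_iff, Prod.ext_iff, ← ite_and,
    mul_ite, mul_one, mul_zero]
  congr 1
  simp only [eq_comm, and_comm]

theorem pInner_Phi0_Phi0 (ψ : OrthonormalBasis (Fin (p + q)) ℂ V) :
    pInner ψ (Phi0 ψ) (Phi0 ψ) = 1 := by
  rw [Phi0, pInner_slater, ← Matrix.det_one (n := Fin p) (R := ℂ)]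
  congr 1
  ext a b
  simp only [Matrix.of_apply, occ, inner_basis, Matrix.one_apply,
    (Fin.castAdd_injective p q).eq_iff]

/-! ### One- and two-electron operators -/

section MatrixUnits

variable {A : Type*} [Ring A] [Algebra ℂ A] {n : ℕ}

/-- The two-electron operator `a†_i a†_j a_l a_k`, expressed by the elements `e i j = a†_i a_j` of
an associative algebra. -/
def twoOp (e : Fin n → Fin n → A) (i j k l : Fin n) : A :=
  e i k * e j l - (if j = k then (1 : ℂ) else 0) • e i l

/-- The operator with one-electron coefficients `a` and two-electron coefficients `b`:
`∑ a_{ij} a†_i a_j + ½ ∑ b_{ijkl} a†_i a†_j a_l a_k`, where `e i j = a†_i a_j`. -/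
def coeffHam (e : Fin n → Fin n → A) (a : Fin n → Fin n → ℂ)
    (b : Fin n → Fin n → Fin n → Fin n → ℂ) : A :=
  (∑ i, ∑ j, a i j • e i j) + (1 / 2 : ℂ) • ∑ i, ∑ j, ∑ k, ∑ l, b i j k l • twoOp e i j k l

/-- One-electron coefficients of the commutator of an operator with `a†_c a_d`. -/
def adOne (a : Fin n → Fin n → ℂ) (c d i j : Fin n) : ℂ :=
  (if d = j then a i c else 0) - (if c = i then a d j else 0)

/-- Two-electron coefficients of the commutator of an operator with `a†_c a_d`. -/
def adTwo (b : Fin n → Fin n → Fin n → Fin n → ℂ) (c d i j k l : Fin n) : ℂ :=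
  (if d = k then b i j c l else 0) + (if d = l then b i j k c else 0)
    - (if c = i then b d j k l else 0) - (if c = j then b i d k l else 0)

theorem twoOp_mul {e : Fin n → Fin n → A}
    (he : ∀ i j k l, e i j * e k l = e k l * e i j
      + ((if j = k then (1 : ℂ) else 0) • e i l - (if l = i then (1 : ℂ) else 0) • e k j))
    (i j k l c d : Fin n) :
    twoOp e i j k l * e c d = e c d * twoOp e i j k l
      + ((if k = c then (1 : ℂ) else 0) • twoOp e i j d l
        + (if l = c then (1 : ℂ) else 0) • twoOp e i j k d
        - (if d = i then (1 : ℂ) else 0) • twoOp e c j k l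
        - (if d = j then (1 : ℂ) else 0) • twoOp e i c k l) := by
  have h3 : e i k * e j l * e c d = e c d * (e i k * e j l)
      + e i k * ((if l = c then (1 : ℂ) else 0) • e j d - (if d = j then (1 : ℂ) else 0) • e c l)
      + ((if k = c then (1 : ℂ) else 0) • e i d - (if d = i then (1 : ℂ) else 0) • e c k)
        * e j l := by
    rw [mul_assoc, he j l c d, mul_add, ← mul_assoc, he i k c d, add_mul, mul_assoc]
    abel
  simp only [twoOp, sub_mul, smul_mul_assoc, h3, he i l c d]
  simp only [mul_sub, mul_smul_comm, smul_add, smul_sub, smul_smul,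
    eq_comm (a := d) (b := j), eq_comm (a := c) (b := k)]
  match_scalars <;> ring

/-- The commutator with `e c d` acts on the coefficients of an operator as the corresponding matrix
unit of `𝔤𝔩ₙ` acts on tensors. -/
theorem coeffHam_mul {e : Fin n → Fin n → A}
    (he : ∀ i j k l, e i j * e k l = e k l * e i j
      + ((if j = k then (1 : ℂ) else 0) • e i l - (if l = i then (1 : ℂ) else 0) • e k j))
    (a : Fin n → Fin n → ℂ) (b : Fin n → Fin n → Fin n → Fin n → ℂ)
    (c d : Fin n) :
    coeffHam e a b * e c d = e c d * coeffHam e a b + coeffHam e (adOne a c d) (adTwo b c d) := by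
  have h1 : (∑ i, ∑ j, a i j • e i j) * e c d
      = e c d * (∑ i, ∑ j, a i j • e i j) + ∑ i, ∑ j, adOne a c d i j • e i j := by
    simp only [Finset.sum_mul, Finset.mul_sum, smul_mul_assoc, mul_smul_comm,
      he _ _ c d, smul_add, smul_sub, Finset.sum_add_distrib,
      Finset.sum_sub_distrib, adOne, sub_smul, ite_smul, smul_ite, zero_smul, smul_zero, one_smul,
      Finset.sum_ite_eq, Finset.sum_ite_eq', Finset.mem_univ, if_true, Finset.sum_ite_irrel,
      Finset.sum_const_zero]
  have h2 : (∑ i, ∑ j, ∑ k, ∑ l, b i j k l • twoOp e i j k l) * e c d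
      = e c d * (∑ i, ∑ j, ∑ k, ∑ l, b i j k l • twoOp e i j k l)
        + ∑ i, ∑ j, ∑ k, ∑ l, adTwo b c d i j k l • twoOp e i j k l := by
    simp only [Finset.sum_mul, Finset.mul_sum, smul_mul_assoc, mul_smul_comm,
      twoOp_mul he _ _ _ _ c d, smul_add, smul_sub, Finset.sum_add_distrib,
      Finset.sum_sub_distrib, adTwo, sub_smul, add_smul, ite_smul, smul_ite, zero_smul, smul_zero,
      one_smul, Finset.sum_ite_eq, Finset.sum_ite_eq', Finset.mem_univ, if_true,
      Finset.sum_ite_irrel, Finset.sum_const_zero]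
  rw [coeffHam, add_mul, mul_add, smul_mul_assoc, mul_smul_comm, h1, h2, coeffHam, smul_add]
  abel

end MatrixUnits

theorem elecHam_eq_coeffHam (ψ : OrthonormalBasis (Fin (p + q)) ℂ V) (h : V →ₗ[ℂ] V)
    (g : V ⊗[ℂ] V →ₗ[ℂ] V ⊗[ℂ] V) :
    elecHam ψ h g = coeffHam (excit ψ) (oneInt ψ h) (twoInt ψ g) := by
  refine LinearMap.ext fun x => Subtype.ext ?_
  have h2 : ∀ i j k l, ((twoOp (excit ψ) i j k l x : ⋀[ℂ]^p V) : ExteriorAlgebra ℂ V)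
      = create ψ i (create ψ j (annih ψ l (annih ψ k x))) :=
    fun i j k l => coe_excit_mul_excit ψ i j k l x
  simp only [elecHam, LinearMap.restrict_apply, fockHam, coeffHam, LinearMap.add_apply,
    LinearMap.smul_apply, LinearMap.sum_apply, LinearMap.comp_apply, Submodule.coe_add,
    Submodule.coe_smul, Submodule.coe_sum, h2, coe_excit]

theorem twoOp_excit_apply (ψ : OrthonormalBasis (Fin (p + q)) ℂ V) (i j k l : Fin (p + q))
    (x : ⋀[ℂ]^p V) : twoOp (excit ψ) i j k l x
      = excit ψ i k (excit ψ j l x) - (if j = k then (1 : ℂ) else 0) • excit ψ i l x := rfl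

/-! ### Expectation values in the reference determinant -/

/-- The adjoint statement to `excit_virt_Phi0`: states containing a virtual
orbital are orthogonal to `Φ₀`. -/
theorem pInner_Phi0_excit_virt (ψ : OrthonormalBasis (Fin (p + q)) ℂ V) (ν : Fin q)
    (i : Fin (p + q)) (x : ⋀[ℂ]^p V) :
    pInner ψ (Phi0 ψ) (excit ψ (Fin.natAdd p ν) i x) = 0 := by
  rw [← pInner_excit_left, excit_virt_Phi0, pInner_zero_left]

theorem pInner_Phi0_excit_Phi0 (ψ : OrthonormalBasis (Fin (p + q)) ℂ V) (μ μ' : Fin p) :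
    pInner ψ (Phi0 ψ) (excit ψ (Fin.castAdd q μ) (Fin.castAdd q μ') (Phi0 ψ))
      = if μ = μ' then 1 else 0 := by
  rw [excit_occ_occ_Phi0, pInner_smul_right, pInner_Phi0_Phi0, mul_one]

theorem pInner_Phi0_twoOp_virt_left (ψ : OrthonormalBasis (Fin (p + q)) ℂ V) (ν : Fin q)
    (j k l : Fin (p + q)) :
    pInner ψ (Phi0 ψ) (twoOp (excit ψ) (Fin.natAdd p ν) j k l (Phi0 ψ)) = 0 := by
  simp only [twoOp_excit_apply,
    pInner_sub_right, pInner_smul_right, pInner_Phi0_excit_virt, mul_zero, sub_zero]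

theorem pInner_Phi0_twoOp_virt_right (ψ : OrthonormalBasis (Fin (p + q)) ℂ V) (ν : Fin q)
    (i j k : Fin (p + q)) :
    pInner ψ (Phi0 ψ) (twoOp (excit ψ) i j k (Fin.natAdd p ν) (Phi0 ψ)) = 0 := by
  simp only [twoOp_excit_apply,
    excit_virt_Phi0, map_zero, smul_zero, sub_zero, pInner_zero_right]

/-- The operator `a†_μ a†_ν a_μ' a_k` has no expectation value in `Φ₀` for `ψ_ν` virtual: commuted
to the left, the creation operator of `ψ_ν` annihilates the bra `⟨Φ₀|`. -/
theorem pInner_Phi0_twoOp_virt_mid (ψ : OrthonormalBasis (Fin (p + q)) ℂ V) (ν : Fin q)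
    (μ μ' : Fin p) (k : Fin (p + q)) :
    pInner ψ (Phi0 ψ) (twoOp (excit ψ) (Fin.castAdd q μ) (Fin.natAdd p ν) k (Fin.castAdd q μ')
      (Phi0 ψ)) = 0 := by
  rw [twoOp_excit_apply, ← Module.End.mul_apply, excit_mul_excit]
  simp only [LinearMap.add_apply, LinearMap.sub_apply, LinearMap.smul_apply,
    Module.End.mul_apply, pInner_add_right, pInner_sub_right, pInner_smul_right,
    pInner_Phi0_excit_virt, mul_zero, sub_zero, zero_add, pInner_Phi0_excit_Phi0,
    eq_comm (a := k), sub_self]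

theorem pInner_Phi0_twoOp_occ (ψ : OrthonormalBasis (Fin (p + q)) ℂ V) (μ μ' ρ : Fin p)
    (k : Fin (p + q)) :
    pInner ψ (Phi0 ψ) (twoOp (excit ψ) (Fin.castAdd q μ) (Fin.castAdd q μ') k (Fin.castAdd q ρ)
      (Phi0 ψ))
      = (if Fin.castAdd q μ = k ∧ μ' = ρ then 1 else 0)
        - (if Fin.castAdd q μ' = k ∧ μ = ρ then 1 else 0) := by
  rw [twoOp_excit_apply,
    excit_occ_occ_Phi0, map_smul, pInner_sub_right, pInner_smul_right, pInner_smul_right,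
    pInner_Phi0_excit_Phi0]
  induction k using Fin.addCases with
  | left k =>
    rw [pInner_Phi0_excit_Phi0]
    simp only [(Fin.castAdd_injective p q).eq_iff, ite_and]
    split_ifs <;> simp_all
  | right k =>
    rw [excit_virt_Phi0, pInner_zero_right]
    simp [castAdd_ne_natAdd]

/-- The expectation value of an operator with given coefficients in the reference determinant. -/
theorem pInner_Phi0_coeffHam (ψ : OrthonormalBasis (Fin (p + q)) ℂ V)
    (a : Fin (p + q) → Fin (p + q) → ℂ)
    (b : Fin (p + q) → Fin (p + q) → Fin (p + q) → Fin (p + q) → ℂ) :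
    pInner ψ (Phi0 ψ) (coeffHam (excit ψ) a b (Phi0 ψ))
      = ∑ μ : Fin p, a (Fin.castAdd q μ) (Fin.castAdd q μ)
        + (1 / 2) * ∑ μ : Fin p, ∑ μ' : Fin p,
          (b (Fin.castAdd q μ) (Fin.castAdd q μ') (Fin.castAdd q μ) (Fin.castAdd q μ')
            - b (Fin.castAdd q μ) (Fin.castAdd q μ') (Fin.castAdd q μ') (Fin.castAdd q μ)) := by
  simp only [coeffHam, LinearMap.add_apply, LinearMap.smul_apply, LinearMap.sum_apply,
    pInner_add_right, pInner_smul_right, pInner_sum_right]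
  congr 1
  · simp only [Fin.sum_univ_add, pInner_Phi0_excit_virt, excit_virt_Phi0, pInner_zero_right,
      pInner_Phi0_excit_Phi0, mul_zero, mul_ite, mul_one, Finset.sum_const_zero, add_zero,
      Finset.sum_ite_eq, Finset.mem_univ, if_true]
  · congr 1
    simp only [Fin.sum_univ_add (fun i => ∑ j, ∑ k, ∑ l, _), pInner_Phi0_twoOp_virt_left,
      mul_zero, Finset.sum_const_zero, add_zero]
    refine Finset.sum_congr rfl fun μ _ => ?_
    simp only [Fin.sum_univ_add, pInner_Phi0_twoOp_virt_right, pInner_Phi0_twoOp_virt_mid,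
      pInner_Phi0_twoOp_occ, mul_zero, Finset.sum_const_zero, add_zero, castAdd_ne_natAdd,
      false_and, if_false, sub_zero, (Fin.castAdd_injective p q).eq_iff, ite_and, mul_sub, mul_ite,
      mul_one, Finset.sum_sub_distrib, Finset.sum_ite_eq, Finset.mem_univ, if_true,
      Finset.sum_ite_irrel]

/-! ### Symmetries of the CIS and constraining matrices -/

theorem E0_eq (ψ : OrthonormalBasis (Fin (p + q)) ℂ V) {H : ⋀[ℂ]^p V →ₗ[ℂ] ⋀[ℂ]^p V}
    (hH : IsHermitianOp ψ H) : (E0 ψ H : ℂ) = pInner ψ (Phi0 ψ) (H (Phi0 ψ)) :=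
  Complex.conj_eq_iff_re.mp (by rw [pInner_conj, hH])

theorem HCIS_isHermitian (ψ : OrthonormalBasis (Fin (p + q)) ℂ V)
    {H : ⋀[ℂ]^p V →ₗ[ℂ] ⋀[ℂ]^p V} (hH : IsHermitianOp ψ H) : (HCIS ψ H).IsHermitian := by
  ext j j'
  change starRingEnd ℂ (pInner ψ _ _) = pInner ψ _ _
  rw [pInner_conj, hH]

/-- The factors `(1 - δ_{νν'}) (1 - δ_{μμ'})` in the definition of `Δ` are automatic when the doubly
excited determinant is written as a product of excitation operators applied to `Φ₀`. -/
theorem Delta_apply (ψ : OrthonormalBasis (Fin (p + q)) ℂ V) (H : ⋀[ℂ]^p V →ₗ[ℂ] ⋀[ℂ]^p V)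
    (j j' : Fin q × Fin p) : Delta ψ H j j' = pInner ψ (Phi0 ψ)
      (H (excit ψ (Fin.natAdd p j'.1) (Fin.castAdd q j'.2) (PhiS ψ j))) := by
  rw [excit_virt_occ_PhiS, Delta, Matrix.of_apply]
  split_ifs
  · rw [map_zero, pInner_zero_right]
  · rfl

theorem excit_virt_occ_comm (ψ : OrthonormalBasis (Fin (p + q)) ℂ V) (j j' : Fin q × Fin p) :
    excit ψ (Fin.natAdd p j'.1) (Fin.castAdd q j'.2) (PhiS ψ j)
      = excit ψ (Fin.natAdd p j.1) (Fin.castAdd q j.2) (PhiS ψ j') := by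
  rw [← Prod.mk.eta (p := j), ← Prod.mk.eta (p := j'), ← excit_virt_occ_Phi0,
    ← excit_virt_occ_Phi0, ← Module.End.mul_apply, excit_mul_excit,
    if_neg (castAdd_ne_natAdd _ _), if_neg (castAdd_ne_natAdd _ _)]
  simp only [LinearMap.add_apply, LinearMap.sub_apply, zero_smul, sub_self,
    add_zero, Module.End.mul_apply]

theorem Delta_isSymm (ψ : OrthonormalBasis (Fin (p + q)) ℂ V) (H : ⋀[ℂ]^p V →ₗ[ℂ] ⋀[ℂ]^p V) :
    (Delta ψ H).IsSymm := by
  ext j j'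
  rw [Matrix.transpose_apply, Delta_apply, Delta_apply, excit_virt_occ_comm]

/-! ### The electronic Hamiltonian is Hermitian -/

theorem oneInt_conj (ψ : OrthonormalBasis (Fin (p + q)) ℂ V) {h : V →ₗ[ℂ] V} (hh : h.IsSymmetric)
    (i j : Fin (p + q)) : starRingEnd ℂ (oneInt ψ h i j) = oneInt ψ h j i := by
  rw [oneInt, inner_conj_symm, hh, oneInt]

theorem twoInt_conj (ψ : OrthonormalBasis (Fin (p + q)) ℂ V)
    {g : V ⊗[ℂ] V →ₗ[ℂ] V ⊗[ℂ] V} (hg : g.IsSymmetric) (i j k l : Fin (p + q)) :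
    starRingEnd ℂ (twoInt ψ g i j k l) = twoInt ψ g k l i j :=
  (inner_conj_symm (𝕜 := ℂ) (g (ψ k ⊗ₜ[ℂ] ψ l)) (ψ i ⊗ₜ[ℂ] ψ j)).trans (hg _ _)

theorem twoInt_swap (ψ : OrthonormalBasis (Fin (p + q)) ℂ V)
    {g : V ⊗[ℂ] V →ₗ[ℂ] V ⊗[ℂ] V}
    (hg : g ∘ₗ (TensorProduct.comm ℂ V V).toLinearMap
      = (TensorProduct.comm ℂ V V).toLinearMap ∘ₗ g) (i j k l : Fin (p + q)) :
    twoInt ψ g j i l k = twoInt ψ g i j k l := by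
  have h := LinearMap.congr_fun hg (ψ k ⊗ₜ[ℂ] ψ l)
  simp only [LinearMap.comp_apply, LinearEquiv.coe_coe, TensorProduct.comm_tmul] at h
  rw [twoInt, h, ← TensorProduct.comm_tmul ℂ V V, TensorProduct.inner_comm_comm, twoInt]

theorem antiInt_conj (ψ : OrthonormalBasis (Fin (p + q)) ℂ V)
    {g : V ⊗[ℂ] V →ₗ[ℂ] V ⊗[ℂ] V} (hg : g.IsSymmetric)
    (hgc : g ∘ₗ (TensorProduct.comm ℂ V V).toLinearMap
      = (TensorProduct.comm ℂ V V).toLinearMap ∘ₗ g) (i j k l : Fin (p + q)) :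
    starRingEnd ℂ (antiInt ψ g i j k l) = antiInt ψ g k l i j := by
  rw [antiInt, map_sub, twoInt_conj ψ hg, twoInt_conj ψ hg, antiInt, twoInt_swap ψ hgc k l j i]

theorem sum_reverse_four {ι M : Type*} [Fintype ι] [AddCommMonoid M] (f : ι → ι → ι → ι → M) :
    ∑ i, ∑ j, ∑ k, ∑ l, f l k j i = ∑ i, ∑ j, ∑ k, ∑ l, f i j k l := by
  have h := Fintype.sum_equiv
    (⟨fun x => (x.2.2.2, x.2.2.1, x.2.1, x.1), fun x => (x.2.2.2, x.2.2.1, x.2.1, x.1),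
      fun _ => rfl, fun _ => rfl⟩ : ι × ι × ι × ι ≃ ι × ι × ι × ι)
    (fun x => f x.2.2.2 x.2.2.1 x.2.1 x.1) (fun x => f x.1 x.2.1 x.2.2.1 x.2.2.2) fun _ => rfl
  simpa only [Fintype.sum_prod_type] using h

theorem pInner_twoOp_left (ψ : OrthonormalBasis (Fin (p + q)) ℂ V) (i j k l : Fin (p + q))
    (x y : ⋀[ℂ]^p V) :
    pInner ψ (twoOp (excit ψ) i j k l x) y = pInner ψ x (twoOp (excit ψ) l k j i y) := by
  simp only [twoOp_excit_apply, pInner_sub_left, pInner_sub_right, pInner_excit_left,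
    pInner_smul_left, pInner_smul_right, eq_comm (a := k), apply_ite (starRingEnd ℂ), map_one,
    map_zero]

theorem coeffHam_isHermitianOp (ψ : OrthonormalBasis (Fin (p + q)) ℂ V)
    {a : Fin (p + q) → Fin (p + q) → ℂ} (ha : ∀ i j, starRingEnd ℂ (a i j) = a j i)
    {b : Fin (p + q) → Fin (p + q) → Fin (p + q) → Fin (p + q) → ℂ}
    (hb : ∀ i j k l, starRingEnd ℂ (b i j k l) = b l k j i) :
    IsHermitianOp ψ (coeffHam (excit ψ) a b : Module.End ℂ (⋀[ℂ]^p V)) := by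
  intro x y
  have h2 : starRingEnd ℂ (1 / 2) = 1 / 2 := by rw [map_div₀, map_one, map_ofNat]
  simp only [coeffHam, LinearMap.add_apply, LinearMap.smul_apply, LinearMap.sum_apply,
    pInner_add_left, pInner_smul_left, pInner_sum_left, pInner_add_right, pInner_smul_right,
    pInner_sum_right, ha, hb, h2, pInner_excit_left, pInner_twoOp_left]
  rw [sum_reverse_four fun i j k l => b i j k l * pInner ψ x (twoOp (excit ψ) i j k l y),
    Finset.sum_comm]

theorem elecHam_isHermitianOp (ψ : OrthonormalBasis (Fin (p + q)) ℂ V) {h : V →ₗ[ℂ] V}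
    {g : V ⊗[ℂ] V →ₗ[ℂ] V ⊗[ℂ] V} (hh : h.IsSymmetric) (hg : g.IsSymmetric)
    (hgc : g ∘ₗ (TensorProduct.comm ℂ V V).toLinearMap
      = (TensorProduct.comm ℂ V V).toLinearMap ∘ₗ g) : IsHermitianOp ψ (elecHam ψ h g) := by
  rw [elecHam_eq_coeffHam]
  exact coeffHam_isHermitianOp ψ (oneInt_conj ψ hh) fun i j k l => by
    rw [twoInt_conj ψ hg, twoInt_swap ψ hgc]

/-! ### Matrix elements of the electronic Hamiltonian between excited determinants -/

theorem coeffHam_mul_excit (ψ : OrthonormalBasis (Fin (p + q)) ℂ V)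
    (a : Fin (p + q) → Fin (p + q) → ℂ)
    (b : Fin (p + q) → Fin (p + q) → Fin (p + q) → Fin (p + q) → ℂ) (c d : Fin (p + q)) :
    (coeffHam (excit ψ) a b * excit ψ c d : Module.End ℂ (⋀[ℂ]^p V))
      = excit ψ c d * coeffHam (excit ψ) a b
        + coeffHam (excit ψ) (adOne a c d) (adTwo b c d) :=
  coeffHam_mul (A := Module.End ℂ (⋀[ℂ]^p V)) (excit_mul_excit ψ) a b c d

/-- The CIS matrix as an expectation value of a double commutator with excitation operators. -/
theorem HCIS_coeffHam (ψ : OrthonormalBasis (Fin (p + q)) ℂ V)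
    (a : Fin (p + q) → Fin (p + q) → ℂ)
    (b : Fin (p + q) → Fin (p + q) → Fin (p + q) → Fin (p + q) → ℂ) (j j' : Fin q × Fin p) :
    HCIS ψ (coeffHam (excit ψ) a b : Module.End ℂ (⋀[ℂ]^p V)) j j'
      = (if j = j' then 1 else 0) * pInner ψ (Phi0 ψ)
          ((coeffHam (excit ψ) a b : Module.End ℂ (⋀[ℂ]^p V)) (Phi0 ψ))
        - pInner ψ (Phi0 ψ) ((coeffHam (excit ψ)
            (adOne (adOne a (Fin.natAdd p j'.1) (Fin.castAdd q j'.2))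
              (Fin.castAdd q j.2) (Fin.natAdd p j.1))
            (adTwo (adTwo b (Fin.natAdd p j'.1) (Fin.castAdd q j'.2))
              (Fin.castAdd q j.2) (Fin.natAdd p j.1)) : Module.End ℂ (⋀[ℂ]^p V)) (Phi0 ψ)) := by
  set H : Module.End ℂ (⋀[ℂ]^p V) := coeffHam (excit ψ) a b with hH
  set H₁ : Module.End ℂ (⋀[ℂ]^p V) := coeffHam (excit ψ)
    (adOne a (Fin.natAdd p j'.1) (Fin.castAdd q j'.2))
    (adTwo b (Fin.natAdd p j'.1) (Fin.castAdd q j'.2)) with hH₁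
  have h1 := LinearMap.congr_fun (coeffHam_mul_excit ψ a b
    (Fin.natAdd p j'.1) (Fin.castAdd q j'.2)) (Phi0 ψ)
  have h2 := LinearMap.congr_fun (coeffHam_mul_excit ψ
    (adOne a (Fin.natAdd p j'.1) (Fin.castAdd q j'.2))
    (adTwo b (Fin.natAdd p j'.1) (Fin.castAdd q j'.2))
    (Fin.castAdd q j.2) (Fin.natAdd p j.1)) (Phi0 ψ)
  rw [← hH, ← hH₁] at h1
  rw [← hH₁] at h2
  simp only [LinearMap.add_apply, Module.End.mul_apply, excit_virt_occ_Phi0, Prod.mk.eta] at h1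
  simp only [LinearMap.add_apply, Module.End.mul_apply, excit_virt_Phi0, map_zero] at h2
  have h3 : pInner ψ (PhiS ψ j) (H₁ (Phi0 ψ)) = pInner ψ (Phi0 ψ)
      (excit ψ (Fin.castAdd q j.2) (Fin.natAdd p j.1) (H₁ (Phi0 ψ))) := by
    rw [← Prod.mk.eta (p := j), ← excit_virt_occ_Phi0, pInner_excit_left]
  rw [HCIS, Matrix.of_apply, h1, pInner_add_right, h3, eq_neg_of_add_eq_zero_left h2.symm,
    ← pInner_excit_left, excit_occ_virt_PhiS, pInner_smul_left, ← neg_one_smul ℂ,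
    pInner_smul_right]
  split_ifs <;> simp [sub_eq_add_neg]

/-- The constraining matrix as an expectation value of a double commutator. -/
theorem Delta_coeffHam (ψ : OrthonormalBasis (Fin (p + q)) ℂ V)
    (a : Fin (p + q) → Fin (p + q) → ℂ)
    (b : Fin (p + q) → Fin (p + q) → Fin (p + q) → Fin (p + q) → ℂ) (j j' : Fin q × Fin p) :
    Delta ψ (coeffHam (excit ψ) a b : Module.End ℂ (⋀[ℂ]^p V)) j j'
      = pInner ψ (Phi0 ψ) ((coeffHam (excit ψ)
            (adOne (adOne a (Fin.natAdd p j'.1) (Fin.castAdd q j'.2))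
              (Fin.natAdd p j.1) (Fin.castAdd q j.2))
            (adTwo (adTwo b (Fin.natAdd p j'.1) (Fin.castAdd q j'.2))
              (Fin.natAdd p j.1) (Fin.castAdd q j.2)) : Module.End ℂ (⋀[ℂ]^p V)) (Phi0 ψ)) := by
  have h1 := LinearMap.congr_fun (coeffHam_mul_excit ψ a b
    (Fin.natAdd p j'.1) (Fin.castAdd q j'.2)) (PhiS ψ j)
  have h2 := LinearMap.congr_fun (coeffHam_mul_excit ψ
    (adOne a (Fin.natAdd p j'.1) (Fin.castAdd q j'.2))
    (adTwo b (Fin.natAdd p j'.1) (Fin.castAdd q j'.2))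
    (Fin.natAdd p j.1) (Fin.castAdd q j.2)) (Phi0 ψ)
  simp only [LinearMap.add_apply, Module.End.mul_apply] at h1
  simp only [LinearMap.add_apply, Module.End.mul_apply, excit_virt_occ_Phi0, Prod.mk.eta] at h2
  rw [Delta_apply, h1, pInner_add_right, pInner_Phi0_excit_virt, h2, pInner_add_right,
    pInner_Phi0_excit_virt, zero_add, zero_add]

/-- Only the two-electron part of the Hamiltonian couples `Φ₀` to doubly excited determinants. -/
theorem Delta_elecHam (ψ : OrthonormalBasis (Fin (p + q)) ℂ V) (h : V →ₗ[ℂ] V)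
    {g : V ⊗[ℂ] V →ₗ[ℂ] V ⊗[ℂ] V}
    (hgc : g ∘ₗ (TensorProduct.comm ℂ V V).toLinearMap
      = (TensorProduct.comm ℂ V V).toLinearMap ∘ₗ g) (j j' : Fin q × Fin p) :
    Delta ψ (elecHam ψ h g) j j' = antiInt ψ g (Fin.castAdd q j.2) (Fin.castAdd q j'.2)
      (Fin.natAdd p j.1) (Fin.natAdd p j'.1) := by
  rw [elecHam_eq_coeffHam, Delta_coeffHam, pInner_Phi0_coeffHam]
  simp only [adOne, adTwo, (Fin.castAdd_injective p q).eq_iff, castAdd_ne_natAdd,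
    (castAdd_ne_natAdd _ _).symm, if_false, sub_zero, zero_add, add_zero, ite_self,
    Finset.sum_const_zero, Finset.sum_add_distrib, Finset.sum_sub_distrib, Finset.sum_ite_eq,
    Finset.mem_univ, if_true, Finset.sum_ite_irrel]
  rw [twoInt_swap ψ hgc (Fin.castAdd q j.2) (Fin.castAdd q j'.2),
    twoInt_swap ψ hgc (Fin.castAdd q j.2) (Fin.castAdd q j'.2), antiInt]
  ring

/-- The CIS matrix of the electronic Hamiltonian for arbitrary orbitals, in terms of the Fock
matrix. -/
theorem HCIS_elecHam (ψ : OrthonormalBasis (Fin (p + q)) ℂ V) (h : V →ₗ[ℂ] V)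
    {g : V ⊗[ℂ] V →ₗ[ℂ] V ⊗[ℂ] V}
    (hgc : g ∘ₗ (TensorProduct.comm ℂ V V).toLinearMap
      = (TensorProduct.comm ℂ V V).toLinearMap ∘ₗ g) (j j' : Fin q × Fin p) :
    HCIS ψ (elecHam ψ h g) j j'
      = (if j = j' then 1 else 0) * pInner ψ (Phi0 ψ) (elecHam ψ h g (Phi0 ψ))
        + (if j.2 = j'.2 then fockMat ψ h g (Fin.natAdd p j.1) (Fin.natAdd p j'.1) else 0)
        - (if j.1 = j'.1 then fockMat ψ h g (Fin.castAdd q j'.2) (Fin.castAdd q j.2) else 0)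
        + antiInt ψ g (Fin.natAdd p j.1) (Fin.castAdd q j'.2)
            (Fin.castAdd q j.2) (Fin.natAdd p j'.1) := by
  -- the exchange symmetry of `g`, oriented so that summation indices come second
  have s₁ : ∀ (μ : Fin p) (k l : Fin (p + q)),
      twoInt ψ g (Fin.castAdd q μ) (Fin.natAdd p j.1) k l
        = twoInt ψ g (Fin.natAdd p j.1) (Fin.castAdd q μ) l k :=
    fun μ k l => twoInt_swap ψ hgc _ _ _ _
  have s₂ : ∀ (μ : Fin p) (k l : Fin (p + q)),
      twoInt ψ g (Fin.castAdd q μ) (Fin.castAdd q j'.2) k l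
        = twoInt ψ g (Fin.castAdd q j'.2) (Fin.castAdd q μ) l k :=
    fun μ k l => twoInt_swap ψ hgc _ _ _ _
  rw [elecHam_eq_coeffHam, HCIS_coeffHam, pInner_Phi0_coeffHam ψ (adOne _ _ _)]
  simp only [adOne, adTwo, (Fin.castAdd_injective p q).eq_iff, (Fin.natAdd_injective q p).eq_iff,
    fockMat, Matrix.of_apply, antiInt,
    (castAdd_ne_natAdd _ _).symm, if_false, sub_zero, add_zero, zero_sub,
    Finset.sum_const_zero, Finset.sum_add_distrib, Finset.sum_sub_distrib, Finset.sum_ite_eq,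
    Finset.mem_univ, if_true, Finset.sum_ite_irrel, Finset.sum_neg_distrib]
  simp only [s₁, s₂, eq_comm (a := j'.1), eq_comm (a := j'.2)]
  split_ifs <;> ring

/-! ### The unitary parametrization -/

theorem finiteDimensional_of_orthonormalBasis (ψ : OrthonormalBasis (Fin (p + q)) ℂ V) :
    FiniteDimensional ℂ V :=
  ψ.toBasis.finiteDimensional_of_finite

theorem zCoord_smul (t : ℝ) (w : Param p q) (j : Fin q × Fin p) :
    zCoord (t • w) j = (t : ℂ) * zCoord w j := by
  simp only [zCoord, Pi.smul_apply, smul_eq_mul, Complex.ofReal_mul]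
  ring

theorem paramOp_smul (ψ : OrthonormalBasis (Fin (p + q)) ℂ V) (t : ℝ) (w : Param p q) :
    paramOp ψ (t • w) = (t : ℂ) • paramOp ψ w := by
  simp only [paramOp, zCoord_smul, map_mul, Complex.conj_ofReal, Finset.smul_sum, smul_sub,
    smul_smul]

theorem paramOp_zero (ψ : OrthonormalBasis (Fin (p + q)) ℂ V) : paramOp ψ 0 = 0 := by
  have h := paramOp_smul ψ 0 0
  rwa [zero_smul, Complex.ofReal_zero, zero_smul] at h

theorem gammaU_zero (ψ : OrthonormalBasis (Fin (p + q)) ℂ V) : gammaU ψ 0 = Phi0 ψ := by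
  simp only [gammaU, paramOp_zero, NormedSpace.exp_zero, one_apply_eq_self]
  rfl

/-- The exponential of a skew-Hermitian operator is unitary. -/
theorem inner_exp_paramOp (ψ : OrthonormalBasis (Fin (p + q)) ℂ V) (w : Param p q) (x y : V) :
    ⟪NormedSpace.exp (paramOp ψ w) x, NormedSpace.exp (paramOp ψ w) y⟫_ℂ = ⟪x, y⟫_ℂ := by
  have := finiteDimensional_of_orthonormalBasis ψ
  have := FiniteDimensional.complete ℂ V
  let _ : NormedAlgebra ℚ (V →L[ℂ] V) := NormedAlgebra.restrictScalars ℚ ℂ _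
  have hskew : paramOp ψ w ∈ skewAdjoint (V →L[ℂ] V) := by
    rw [skewAdjoint.mem_iff, paramOp, star_sum, ← Finset.sum_neg_distrib]
    refine Finset.sum_congr rfl fun j _ => ?_
    rw [star_sub, star_smul, star_smul, ContinuousLinearMap.star_eq_adjoint,
      ContinuousLinearMap.star_eq_adjoint, InnerProductSpace.adjoint_rankOne,
      InnerProductSpace.adjoint_rankOne, neg_sub]
    simp
  have hu := (Unitary.mem_iff.mp (NormedSpace.exp_mem_unitary_of_mem_skewAdjoint hskew)).1
  rw [← ContinuousLinearMap.adjoint_inner_right, ← ContinuousLinearMap.star_eq_adjoint,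
    ← mul_apply_eq_comp, hu, one_apply_eq_self]

theorem pInner_gammaU (ψ : OrthonormalBasis (Fin (p + q)) ℂ V) (w : Param p q) :
    pInner ψ (gammaU ψ w) (gammaU ψ w) = 1 := by
  rw [← pInner_Phi0_Phi0 ψ, gammaU, Phi0, pInner_slater, pInner_slater]
  simp only [inner_exp_paramOp]

theorem gammaU_ne_zero (ψ : OrthonormalBasis (Fin (p + q)) ℂ V) (w : Param p q) :
    gammaU ψ w ≠ 0 := by
  intro h
  have := pInner_gammaU ψ w
  rw [h, pInner_zero_left] at this
  exact zero_ne_one this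

theorem mk_gammaU_mem_HF (ψ : OrthonormalBasis (Fin (p + q)) ℂ V) (w : Param p q)
    (hne : gammaU ψ w ≠ 0) : Projectivization.mk ℂ (gammaU ψ w) hne ∈ HF p V := by
  refine ⟨fun μ => NormedSpace.exp (paramOp ψ w) (occ ψ μ), ?_, ?_⟩
  · refine Orthonormal.linearIndependent (orthonormal_iff_ite.mpr fun a b => ?_)
    rw [inner_exp_paramOp, occ, occ, inner_basis]
    simp only [(Fin.castAdd_injective p q).eq_iff]
  · rw [Projectivization.submodule_mk]
    rfl

/-- The energy quotient is invariant under rescaling, in particular under passing to the chosen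
representative of a line, and its denominator is `1` at the unit vector `γ^U(Z)`. -/
theorem energy_eq_projEnergy (ψ : OrthonormalBasis (Fin (p + q)) ℂ V) (w : Param p q)
    (hne : gammaU ψ w ≠ 0) (H : ⋀[ℂ]^p V →ₗ[ℂ] ⋀[ℂ]^p V) :
    energy ψ H w = projEnergy ψ H (Projectivization.mk ℂ (gammaU ψ w) hne) := by
  obtain ⟨a, ha⟩ := Projectivization.exists_smul_eq_mk_rep ℂ (gammaU ψ w) hne
  have hc : ∀ z : ℂ, (a : ℂ) * (starRingEnd ℂ (a : ℂ) * z) = (Complex.normSq a : ℂ) * z := by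
    intro z
    rw [← mul_assoc, Complex.mul_conj]
  have ha0 : Complex.normSq (a : ℂ) ≠ 0 := by simp
  rw [projEnergy, ← ha, Units.smul_def, map_smul, pInner_smul_right, pInner_smul_right,
    pInner_smul_left, pInner_smul_left, hc, hc, pInner_gammaU, energy]
  simp only [Complex.re_ofReal_mul, mul_one, Complex.ofReal_re]
  rw [mul_div_cancel_left₀ _ ha0]

/-! ### Differentiation of the energy -/

/-- Coordinates of Slater determinants are minors of the coordinate matrix of the vectors. -/
theorem coordP_slater (ψ : OrthonormalBasis (Fin (p + q)) ℂ V) (x : Fin p → V)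
    (s : Set.powersetCard (Fin (p + q)) p) : coordP ψ (slater x) s
      = (Matrix.of fun i j => ⟪ψ (Set.powersetCard.ofFinEmbEquiv.symm s j), x i⟫_ℂ).det := by
  change (ψ.toBasis.exteriorPower p).repr (slater x) s = _
  simp only [exteriorPower.basis_repr_apply, slater, exteriorPower.ιMultiDual_apply_ιMulti]
  congr 1
  ext i j
  simp [OrthonormalBasis.repr_apply_apply]

/-- The Slater determinant in coordinates, as a continuous multilinear map. -/
def slaterCoord (ψ : OrthonormalBasis (Fin (p + q)) ℂ V) :
    ContinuousMultilinearMap ℂ (fun _ : Fin p => V)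
      (EuclideanSpace ℂ (Set.powersetCard (Fin (p + q)) p)) where
  toMultilinearMap := (coordP ψ).toLinearMap.compMultilinearMap
    (exteriorPower.ιMulti ℂ p).toMultilinearMap
  cont := by
    refine (PiLp.continuous_toLp 2 _).comp (continuous_pi fun s => ?_)
    change Continuous fun x : Fin p → V => coordP ψ (slater x) s
    simp only [coordP_slater]
    refine Continuous.matrix_det (continuous_matrix fun i j => ?_)
    exact continuous_const.inner (continuous_apply i)

theorem contDiff_zCoord (j : Fin q × Fin p) {n : WithTop ℕ∞} :
    ContDiff ℝ n fun w : Param p q => zCoord w j :=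
  (Complex.ofRealCLM.contDiff.comp (contDiff_apply ℝ ℝ _)).add
    (contDiff_const.mul (Complex.ofRealCLM.contDiff.comp (contDiff_apply ℝ ℝ _)))

theorem contDiff_paramOp (ψ : OrthonormalBasis (Fin (p + q)) ℂ V) {n : WithTop ℕ∞} :
    ContDiff ℝ n (paramOp ψ) := by
  unfold paramOp
  refine ContDiff.sum fun j _ => ContDiff.sub ?_ ?_
  · exact (contDiff_zCoord j).smul contDiff_const
  · exact (Complex.conjCLE.contDiff.comp (contDiff_zCoord j)).smul contDiff_const

theorem contDiff_coordP_gammaU (ψ : OrthonormalBasis (Fin (p + q)) ℂ V) :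
    ContDiff ℝ ∞ fun w => coordP ψ (gammaU ψ w) := by
  have := finiteDimensional_of_orthonormalBasis ψ
  have := FiniteDimensional.complete ℂ V
  have hexp : ContDiff ℝ ∞ (NormedSpace.exp : (V →L[ℂ] V) → (V →L[ℂ] V)) :=
    contDiff_iff_contDiffAt.mpr fun x =>
      (NormedSpace.exp_analytic (𝕂 := ℂ) x).contDiffAt.restrict_scalars ℝ
  refine ((slaterCoord ψ).contDiff.restrict_scalars ℝ).comp (contDiff_pi.mpr fun μ => ?_)
  exact (((ContinuousLinearMap.apply ℂ V (occ ψ μ)).contDiff.restrict_scalars ℝ).comp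
    (hexp.comp (contDiff_paramOp ψ)))

/-- An operator on the `p`-electron space in coordinates. -/
def opCoord (ψ : OrthonormalBasis (Fin (p + q)) ℂ V) (A : Module.End ℂ (⋀[ℂ]^p V)) :
    EuclideanSpace ℂ (Set.powersetCard (Fin (p + q)) p) →L[ℂ]
      EuclideanSpace ℂ (Set.powersetCard (Fin (p + q)) p) :=
  LinearMap.toContinuousLinearMap ((coordP ψ).conj A)

theorem opCoord_coordP (ψ : OrthonormalBasis (Fin (p + q)) ℂ V) (A : Module.End ℂ (⋀[ℂ]^p V))
    (x : ⋀[ℂ]^p V) : opCoord ψ A (coordP ψ x) = coordP ψ (A x) := by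
  simp [opCoord, LinearEquiv.conj_apply]

theorem contDiff_energy (ψ : OrthonormalBasis (Fin (p + q)) ℂ V)
    (H : ⋀[ℂ]^p V →ₗ[ℂ] ⋀[ℂ]^p V) : ContDiff ℝ ∞ (energy ψ H) := by
  have h := contDiff_coordP_gammaU ψ
  have h2 := ((opCoord ψ H).contDiff.restrict_scalars ℝ).comp h
  have h3 := contDiff_const (c := (1 / 2 : ℝ)).mul (Complex.reCLM.contDiff.comp (h.inner ℂ h2))
  have hE : energy ψ H = fun w => (1 / 2 : ℝ)
      * (⟪coordP ψ (gammaU ψ w), opCoord ψ H (coordP ψ (gammaU ψ w))⟫_ℂ).re := by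
    funext w
    rw [energy, pInner_eq_inner, opCoord_coordP]
  rw [hE]
  exact h3

/-- The derivation of the `p`-electron space induced by the one-electron operator `paramOp ψ w`. -/
def genOp (ψ : OrthonormalBasis (Fin (p + q)) ℂ V) (w : Param p q) : Module.End ℂ (⋀[ℂ]^p V) :=
  ∑ j : Fin q × Fin p, (zCoord w j • excit ψ (Fin.natAdd p j.1) (Fin.castAdd q j.2)
    - starRingEnd ℂ (zCoord w j) • excit ψ (Fin.castAdd q j.2) (Fin.natAdd p j.1))

theorem genOp_slater (ψ : OrthonormalBasis (Fin (p + q)) ℂ V) (w : Param p q) (x : Fin p → V) :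
    genOp ψ w (slater x) = ∑ m, slater (Function.update x m (paramOp ψ w (x m))) := by
  have hlin : ∀ m, slater (Function.update x m (paramOp ψ w (x m)))
      = ∑ j : Fin q × Fin p,
        (zCoord w j • slater (Function.update x m (⟪occ ψ j.2, x m⟫_ℂ • virt ψ j.1))
        - starRingEnd ℂ (zCoord w j)
          • slater (Function.update x m (⟪virt ψ j.1, x m⟫_ℂ • occ ψ j.2))) := by
    intro m
    have : ∀ v, slater (Function.update x m v)
        = (exteriorPower.ιMulti ℂ p).toMultilinearMap.toLinearMap x m v := fun v => rfl
    simp only [this, ← map_smul, ← map_sub, ← map_sum]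
    congr 1
    simp [paramOp]
  simp only [hlin, genOp, LinearMap.sum_apply, LinearMap.sub_apply, LinearMap.smul_apply,
    excit_slater, Finset.smul_sum]
  rw [Finset.sum_comm]
  simp only [Finset.sum_sub_distrib]
  rfl

/-- Along a line through the origin `γ^U` solves the linear equation `γ' = N γ` with the derivation
`N = genOp ψ u`: the vectors `exp(tU) ψ_μ` solve `x' = U x`, and the determinant is multilinear. -/
theorem hasDerivAt_coordP_gammaU (ψ : OrthonormalBasis (Fin (p + q)) ℂ V) (u : Param p q)
    (t : ℝ) : HasDerivAt (fun t : ℝ => coordP ψ (gammaU ψ (t • u)))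
      (coordP ψ (genOp ψ u (gammaU ψ (t • u)))) t := by
  have := finiteDimensional_of_orthonormalBasis ψ
  have := FiniteDimensional.complete ℂ V
  have h1 : HasDerivAt (fun t : ℝ => NormedSpace.exp (paramOp ψ (t • u)))
      (paramOp ψ u * NormedSpace.exp (paramOp ψ (t • u))) t := by
    simp only [paramOp_smul]
    have h := (hasDerivAt_exp_smul_const' (𝕂 := ℂ) (paramOp ψ u) (t : ℂ)).scomp t
      Complex.ofRealCLM.hasDerivAt
    rw [Complex.ofRealCLM_apply, Complex.ofReal_one, one_smul] at h
    exact h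
  have h2 : HasDerivAt (fun t : ℝ => fun μ => NormedSpace.exp (paramOp ψ (t • u)) (occ ψ μ))
      (fun μ => paramOp ψ u (NormedSpace.exp (paramOp ψ (t • u)) (occ ψ μ))) t := by
    refine hasDerivAt_pi.mpr fun μ => ?_
    exact (((ContinuousLinearMap.apply ℂ V (occ ψ μ)).hasFDerivAt.restrictScalars
      ℝ).comp_hasDerivAt t h1)
  have h3 := (((slaterCoord ψ).hasFDerivAt
    (fun μ => NormedSpace.exp (paramOp ψ (t • u)) (occ ψ μ))).restrictScalars
      ℝ).comp_hasDerivAt t h2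
  have hd : coordP ψ (genOp ψ u (gammaU ψ (t • u)))
      = (slaterCoord ψ).linearDeriv (fun μ => NormedSpace.exp (paramOp ψ (t • u)) (occ ψ μ))
        (fun μ => paramOp ψ u (NormedSpace.exp (paramOp ψ (t • u)) (occ ψ μ))) := by
    rw [gammaU, genOp_slater, map_sum, ContinuousMultilinearMap.linearDeriv_apply]
    rfl
  rw [hd]
  exact h3

theorem hasDerivAt_pInner_gammaU (ψ : OrthonormalBasis (Fin (p + q)) ℂ V)
    (A B : Module.End ℂ (⋀[ℂ]^p V)) (u : Param p q) (t : ℝ) :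
    HasDerivAt (fun t : ℝ => pInner ψ (A (gammaU ψ (t • u))) (B (gammaU ψ (t • u))))
      (pInner ψ (A (gammaU ψ (t • u))) (B (genOp ψ u (gammaU ψ (t • u))))
        + pInner ψ (A (genOp ψ u (gammaU ψ (t • u)))) (B (gammaU ψ (t • u)))) t := by
  have h := hasDerivAt_coordP_gammaU ψ u t
  have h2 : ∀ A : Module.End ℂ (⋀[ℂ]^p V), HasDerivAt
      (fun t : ℝ => coordP ψ (A (gammaU ψ (t • u))))
      (coordP ψ (A (genOp ψ u (gammaU ψ (t • u))))) t := by
    intro A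
    have := ((opCoord ψ A).hasFDerivAt.restrictScalars ℝ).comp_hasDerivAt t h
    simpa only [Function.comp_def, opCoord_coordP, ContinuousLinearMap.coe_restrictScalars']
      using this
  simpa only [pInner_eq_inner] using (h2 A).inner ℂ (h2 B)

/-! ### First and second derivative of the energy at the origin -/

theorem genOp_Phi0 (ψ : OrthonormalBasis (Fin (p + q)) ℂ V) (u : Param p q) :
    genOp ψ u (Phi0 ψ) = ∑ j, zCoord u j • PhiS ψ j := by
  simp only [genOp, LinearMap.sum_apply, LinearMap.sub_apply, LinearMap.smul_apply,
    excit_virt_Phi0, excit_virt_occ_Phi0, smul_zero, sub_zero]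

/-- A second application of the generator either excites once more, which gives `Δ`, or undoes the
first excitation, which gives `-|z_j|² E₀`. -/
theorem pInner_Phi0_genOp_genOp (ψ : OrthonormalBasis (Fin (p + q)) ℂ V)
    (H : ⋀[ℂ]^p V →ₗ[ℂ] ⋀[ℂ]^p V) (u : Param p q) :
    pInner ψ (Phi0 ψ) (H (genOp ψ u (genOp ψ u (Phi0 ψ))))
      = ∑ j, ∑ j', (zCoord u j * zCoord u j' * Delta ψ H j j'
        - if j = j' then starRingEnd ℂ (zCoord u j) * zCoord u j'
            * pInner ψ (Phi0 ψ) (H (Phi0 ψ)) else 0) := by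
  rw [genOp_Phi0, map_sum, map_sum, pInner_sum_right]
  refine Finset.sum_congr rfl fun j _ => ?_
  simp only [genOp, map_smul, LinearMap.sum_apply, LinearMap.sub_apply, LinearMap.smul_apply,
    excit_occ_virt_PhiS, map_sum, map_sub, pInner_smul_right, pInner_sum_right, pInner_sub_right,
    ← Delta_apply, Finset.mul_sum]
  refine Finset.sum_congr rfl fun j' _ => ?_
  split_ifs with h
  · subst h
    ring
  · ring

theorem hasDerivAt_energy_line (ψ : OrthonormalBasis (Fin (p + q)) ℂ V)
    {H : ⋀[ℂ]^p V →ₗ[ℂ] ⋀[ℂ]^p V} (hH : IsHermitianOp ψ H) (u : Param p q) (t : ℝ) :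
    HasDerivAt (fun t : ℝ => energy ψ H (t • u))
      (pInner ψ (gammaU ψ (t • u)) (H (genOp ψ u (gammaU ψ (t • u))))).re t := by
  have h := (hasDerivAt_pInner_gammaU ψ 1 H u t)
  have h2 := (Complex.reCLM.hasFDerivAt.comp_hasDerivAt t h).const_mul (1 / 2 : ℝ)
  -- the two terms of the Leibniz rule are complex conjugates of each other
  have hre : (pInner ψ (genOp ψ u (gammaU ψ (t • u))) (H (gammaU ψ (t • u)))).re
      = (pInner ψ (gammaU ψ (t • u)) (H (genOp ψ u (gammaU ψ (t • u))))).re := by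
    rw [← hH, ← pInner_conj ψ _ (H _), Complex.conj_re]
  simp only [Module.End.one_apply, Complex.reCLM_apply, Complex.add_re, hre] at h2
  rw [← mul_two, mul_comm, mul_assoc, mul_one_div_cancel two_ne_zero, mul_one] at h2
  exact h2

theorem fderiv_energy_line (ψ : OrthonormalBasis (Fin (p + q)) ℂ V)
    {H : ⋀[ℂ]^p V →ₗ[ℂ] ⋀[ℂ]^p V} (hH : IsHermitianOp ψ H) (u : Param p q) (t : ℝ) :
    fderiv ℝ (energy ψ H) (t • u) u
      = (pInner ψ (gammaU ψ (t • u)) (H (genOp ψ u (gammaU ψ (t • u))))).re := by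
  have hline : HasDerivAt (fun t : ℝ => t • u) u t := by
    simpa using (hasDerivAt_id t).smul_const u
  have hdiff : DifferentiableAt ℝ (energy ψ H) (t • u) :=
    (contDiff_energy ψ H).differentiable (by simp) _
  have h := HasFDerivAt.comp_hasDerivAt (f := fun t : ℝ => t • u) t hdiff.hasFDerivAt hline
  exact h.unique (hasDerivAt_energy_line ψ hH u t)

theorem fderiv_energy_zero (ψ : OrthonormalBasis (Fin (p + q)) ℂ V)
    {H : ⋀[ℂ]^p V →ₗ[ℂ] ⋀[ℂ]^p V} (hH : IsHermitianOp ψ H) (u : Param p q) :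
    fderiv ℝ (energy ψ H) 0 u
      = (∑ j, zCoord u j * pInner ψ (Phi0 ψ) (H (PhiS ψ j))).re := by
  have h := fderiv_energy_line ψ hH u 0
  rw [zero_smul, gammaU_zero, genOp_Phi0, map_sum, pInner_sum_right] at h
  simpa only [map_smul, pInner_smul_right] using h

theorem zCoord_single_inl (j j' : Fin q × Fin p) :
    zCoord (Pi.single (Sum.inl j) 1 : Param p q) j' = if j' = j then 1 else 0 := by
  simp [zCoord, Pi.single_apply, apply_ite Complex.ofReal]

theorem zCoord_single_inr (j j' : Fin q × Fin p) :
    zCoord (Pi.single (Sum.inr j) 1 : Param p q) j' = if j' = j then Complex.I else 0 := by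
  simp [zCoord, Pi.single_apply, apply_ite Complex.ofReal]

theorem fderiv_energy_eq_zero_iff (ψ : OrthonormalBasis (Fin (p + q)) ℂ V)
    {H : ⋀[ℂ]^p V →ₗ[ℂ] ⋀[ℂ]^p V} (hH : IsHermitianOp ψ H) :
    fderiv ℝ (energy ψ H) 0 = 0 ↔ Brillouin ψ H := by
  have hb : ∀ j, pInner ψ (PhiS ψ j) (H (Phi0 ψ)) = 0 ↔ pInner ψ (Phi0 ψ) (H (PhiS ψ j)) = 0 := by
    intro j
    rw [← hH, ← pInner_conj, map_eq_zero]
  simp only [Brillouin, hb]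
  constructor
  · intro h j
    -- the directions `X_j` and `Y_j` give the real part and minus the imaginary part
    have hx := fderiv_energy_zero ψ hH (Pi.single (Sum.inl j) 1)
    have hy := fderiv_energy_zero ψ hH (Pi.single (Sum.inr j) 1)
    simp only [h, zCoord_single_inl, zCoord_single_inr, zero_apply, ite_mul,
      one_mul, zero_mul, Finset.sum_ite_eq', Finset.mem_univ, if_true, Complex.I_mul_re] at hx hy
    exact Complex.ext hx.symm (neg_eq_zero.mp hy.symm)
  · intro h
    ext1 u
    rw [fderiv_energy_zero ψ hH]
    simp [h]

theorem hess_isSymm (ψ : OrthonormalBasis (Fin (p + q)) ℂ V)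
    {H : ⋀[ℂ]^p V →ₗ[ℂ] ⋀[ℂ]^p V} (hH : IsHermitianOp ψ H) : (hess ψ H).IsSymm := by
  have hC : ∀ j j', HCIS ψ H j j' = starRingEnd ℂ (HCIS ψ H j' j) :=
    fun j j' => ((HCIS_isHermitian ψ hH).apply j j').symm
  have hD : ∀ j j', Delta ψ H j j' = Delta ψ H j' j := fun j j' => (Delta_isSymm ψ H).apply j' j
  ext i j
  rcases i with i | i <;> rcases j with j | j <;>
    simp [hess, hC i j, hD i j, Matrix.one_apply, eq_comm (a := i) (b := j)] <;> ring

theorem dotProduct_hess (ψ : OrthonormalBasis (Fin (p + q)) ℂ V)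
    (H : ⋀[ℂ]^p V →ₗ[ℂ] ⋀[ℂ]^p V) (u : Param p q) :
    u ⬝ᵥ (hess ψ H *ᵥ u) = ∑ j, ∑ j', (zCoord u j * zCoord u j' * Delta ψ H j j'
        - (if j = j' then starRingEnd ℂ (zCoord u j) * zCoord u j' * (E0 ψ H : ℂ) else 0)
        + starRingEnd ℂ (zCoord u j) * zCoord u j' * HCIS ψ H j j').re := by
  simp only [dotProduct, Matrix.mulVec, Fintype.sum_sum_type, Finset.mul_sum, mul_add,
    ← Finset.sum_add_distrib, hess, Matrix.fromBlocks_apply₁₁, Matrix.fromBlocks_apply₁₂,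
    Matrix.fromBlocks_apply₂₁, Matrix.fromBlocks_apply₂₂]
  refine Finset.sum_congr rfl fun j _ => Finset.sum_congr rfl fun j' _ => ?_
  rcases eq_or_ne j j' with rfl | h
  · simp [zCoord]
    ring
  · simp [zCoord, h]
    ring

theorem hasDerivAt_line_apply {E : Type*} [NormedAddCommGroup E] [NormedSpace ℝ E]
    {F : E → E →L[ℝ] ℝ} (hF : DifferentiableAt ℝ F 0) (u : E) :
    HasDerivAt (fun t : ℝ => F (t • u) u) (fderiv ℝ F 0 u u) 0 := by
  have hline : HasDerivAt (fun t : ℝ => t • u) u 0 := by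
    simpa using (hasDerivAt_id (0 : ℝ)).smul_const u
  have hF' : HasFDerivAt F (fderiv ℝ F 0) ((0 : ℝ) • u) := by
    rw [zero_smul]
    exact hF.hasFDerivAt
  have h := HasFDerivAt.comp_hasDerivAt (f := fun t : ℝ => t • u) (0 : ℝ) hF' hline
  exact (ContinuousLinearMap.apply ℝ ℝ u).hasFDerivAt.comp_hasDerivAt (0 : ℝ) h

/-- The Hessian of the energy on the diagonal, as the second derivative along a line. -/
theorem fderiv_fderiv_energy_self (ψ : OrthonormalBasis (Fin (p + q)) ℂ V)
    {H : ⋀[ℂ]^p V →ₗ[ℂ] ⋀[ℂ]^p V} (hH : IsHermitianOp ψ H) (u : Param p q) :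
    fderiv ℝ (fderiv ℝ (energy ψ H)) 0 u u = u ⬝ᵥ (hess ψ H *ᵥ u) := by
  have h1 := hasDerivAt_line_apply
    (((contDiff_energy ψ H).fderiv_right (m := 1) (by norm_cast)).differentiable (by simp) 0) u
  have h2 := Complex.reCLM.hasFDerivAt.comp_hasDerivAt (0 : ℝ)
    (hasDerivAt_pInner_gammaU ψ 1 (H * genOp ψ u) u 0)
  have h3 : (fun t : ℝ => fderiv ℝ (energy ψ H) (t • u) u) = Complex.reCLM ∘ fun t : ℝ =>
      pInner ψ ((1 : Module.End ℂ (⋀[ℂ]^p V)) (gammaU ψ (t • u)))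
        ((H * genOp ψ u : Module.End ℂ (⋀[ℂ]^p V)) (gammaU ψ (t • u))) := by
    funext t
    rw [fderiv_energy_line ψ hH]
    rfl
  rw [h3] at h1
  rw [h1.unique h2, zero_smul, gammaU_zero, Module.End.one_apply, Module.End.mul_apply,
    Module.End.one_apply, Module.End.mul_apply, pInner_Phi0_genOp_genOp, genOp_Phi0,
    dotProduct_hess, E0_eq ψ hH, pInner_sum_left]
  simp only [map_sum, map_smul, pInner_sum_right, pInner_smul_left, pInner_smul_right,
    Complex.reCLM_apply, map_add, Complex.add_re, Finset.sum_add_distrib, HCIS,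
    Matrix.of_apply, mul_assoc, mul_left_comm (zCoord u _) (starRingEnd ℂ _)]

theorem dotProduct_hess_comm (ψ : OrthonormalBasis (Fin (p + q)) ℂ V)
    {H : ⋀[ℂ]^p V →ₗ[ℂ] ⋀[ℂ]^p V} (hH : IsHermitianOp ψ H) (u v : Param p q) :
    u ⬝ᵥ (hess ψ H *ᵥ v) = v ⬝ᵥ (hess ψ H *ᵥ u) := by
  rw [Matrix.dotProduct_mulVec, ← Matrix.mulVec_transpose, (hess_isSymm ψ hH).eq, dotProduct_comm]

/-- The Hessian of the energy; both sides are symmetric bilinear forms, so that it suffices to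
compare them on the diagonal. -/
theorem fderiv_fderiv_energy (ψ : OrthonormalBasis (Fin (p + q)) ℂ V)
    {H : ⋀[ℂ]^p V →ₗ[ℂ] ⋀[ℂ]^p V} (hH : IsHermitianOp ψ H) (u v : Param p q) :
    fderiv ℝ (fderiv ℝ (energy ψ H)) 0 u v = u ⬝ᵥ (hess ψ H *ᵥ v) := by
  have hs : fderiv ℝ (fderiv ℝ (energy ψ H)) 0 u v = fderiv ℝ (fderiv ℝ (energy ψ H)) 0 v u :=
    ((contDiff_energy ψ H).contDiffAt (x := 0)).isSymmSndFDerivAt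
      (by simp; norm_cast) u v
  have huv := fderiv_fderiv_energy_self ψ hH (u + v)
  have hu := fderiv_fderiv_energy_self ψ hH u
  have hv := fderiv_fderiv_energy_self ψ hH v
  simp only [map_add, add_apply, Matrix.mulVec_add, dotProduct_add,
    add_dotProduct] at huv
  have hc := dotProduct_hess_comm ψ hH u v
  linarith

/-! ### The Hamiltonian vector field -/

theorem omega_eq (u v : Param p q) : omega u v = u ⬝ᵥ (Om p q *ᵥ v) := by
  simp [omega, Om, dotProduct, Fintype.sum_sum_type, Matrix.mulVec, Matrix.one_apply,
    Finset.sum_add_distrib, sub_eq_add_neg]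

theorem Om_mul_Om : Om p q * Om p q = -1 := by
  rw [Om, Matrix.fromBlocks_multiply, ← Matrix.fromBlocks_one, Matrix.fromBlocks_neg]
  simp

/-- The gradient of a function on the parameter space with respect to the coordinates. -/
def coordGrad (f : Param p q → ℝ) (w : Param p q) : Param p q :=
  fun i => fderiv ℝ f w (Pi.single i 1)

theorem dotProduct_coordGrad (f : Param p q → ℝ) (w u : Param p q) :
    u ⬝ᵥ coordGrad f w = fderiv ℝ f w u := by
  conv_rhs => rw [pi_eq_sum_univ' u, map_sum]
  simp only [map_smul, smul_eq_mul, dotProduct, coordGrad]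

/-- Since `Ω² = -1`, the symplectic gradient is `-Ω` times the coordinate gradient. -/
theorem isSymplecticGradient_iff (f : Param p q → ℝ) (ξ : Param p q → Param p q) :
    IsSymplecticGradient f ξ ↔ ξ = fun w => -Om p q *ᵥ coordGrad f w := by
  have hO : ∀ x y : Param p q, Om p q *ᵥ x = y ↔ x = -Om p q *ᵥ y := by
    intro x y
    constructor
    · rintro rfl
      rw [Matrix.mulVec_mulVec, neg_mul, Om_mul_Om, neg_neg, Matrix.one_mulVec]
    · rintro rfl
      rw [Matrix.mulVec_mulVec, mul_neg, Om_mul_Om, neg_neg, Matrix.one_mulVec]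
  simp only [IsSymplecticGradient, omega_eq, ← dotProduct_coordGrad, funext_iff (f := ξ), ← hO]
  refine forall_congr' fun w => ⟨fun h => ?_, fun h u => by rw [h]⟩
  exact dotProduct_eq _ _ fun u => by rw [dotProduct_comm, h, dotProduct_comm]

theorem coordGrad_eq_zero_iff (f : Param p q → ℝ) (w : Param p q) :
    coordGrad f w = 0 ↔ fderiv ℝ f w = 0 := by
  constructor
  · intro h
    ext1 u
    rw [← dotProduct_coordGrad, h, dotProduct_zero, zero_apply]
  · intro h
    funext i
    rw [coordGrad, h]
    rfl

theorem symplecticGradient_zero_iff {f : Param p q → ℝ} {ξ : Param p q → Param p q}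
    (hξ : IsSymplecticGradient f ξ) (w : Param p q) : ξ w = 0 ↔ fderiv ℝ f w = 0 := by
  rw [(isSymplecticGradient_iff f ξ).mp hξ, ← coordGrad_eq_zero_iff]
  refine ⟨fun h => ?_, fun h => by simp only [h, Matrix.mulVec_zero]⟩
  have h2 := congrArg (Om p q *ᵥ ·) h
  simpa only [Matrix.mulVec_mulVec, mul_neg, Om_mul_Om, neg_neg, Matrix.one_mulVec,
    Matrix.mulVec_zero] using h2

theorem hasFDerivAt_coordGrad_energy (ψ : OrthonormalBasis (Fin (p + q)) ℂ V)
    {H : ⋀[ℂ]^p V →ₗ[ℂ] ⋀[ℂ]^p V} (hH : IsHermitianOp ψ H) :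
    HasFDerivAt (coordGrad (energy ψ H))
      (LinearMap.toContinuousLinearMap (Matrix.mulVecLin (hess ψ H))) 0 := by
  have hdiff : DifferentiableAt ℝ (fderiv ℝ (energy ψ H)) 0 :=
    ((contDiff_energy ψ H).fderiv_right (m := 1) (by norm_cast)).differentiable (by simp) _
  refine hasFDerivAt_pi'.mpr fun i => ?_
  have h := hdiff.hasFDerivAt.clm_apply (hasFDerivAt_const (Pi.single i 1 : Param p q) 0)
  refine h.congr_fderiv ?_
  ext1 v
  have hv : fderiv ℝ (fderiv ℝ (energy ψ H)) 0 v (Pi.single i 1) = (hess ψ H *ᵥ v) i := by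
    rw [fderiv_fderiv_energy ψ hH, dotProduct_hess_comm ψ hH, single_one_dotProduct]
  simpa using hv

theorem hasFDerivAt_symplecticGradient (ψ : OrthonormalBasis (Fin (p + q)) ℂ V)
    {H : ⋀[ℂ]^p V →ₗ[ℂ] ⋀[ℂ]^p V} (hH : IsHermitianOp ψ H) {ξ : Param p q → Param p q}
    (hξ : IsSymplecticGradient (energy ψ H) ξ) :
    HasFDerivAt ξ
      (LinearMap.toContinuousLinearMap (Matrix.mulVecLin (-(Om p q * hess ψ H)))) 0 := by
  rw [(isSymplecticGradient_iff _ ξ).mp hξ]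
  have h := (LinearMap.toContinuousLinearMap (Matrix.mulVecLin (-Om p q))).hasFDerivAt.comp
    (0 : Param p q) (hasFDerivAt_coordGrad_energy ψ hH)
  refine h.congr_fderiv ?_
  ext1 v
  simp [Matrix.mulVec_mulVec]

/-! ### Complexification of the linearized equations -/

/-- The inverse `[[I, i I], [I, -i I]]` of `Cmat`, which maps `(X, Y)` to `(Z, conj Z)`. -/
def Dmat (p q : ℕ) : Matrix (Idx p q) (Idx p q) ℂ :=
  Matrix.fromBlocks 1 (Complex.I • (1 : Matrix _ _ ℂ)) 1 (-(Complex.I • (1 : Matrix _ _ ℂ)))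

theorem Cmat_mul_Dmat : Cmat p q * Dmat p q = 1 := by
  rw [Cmat, Dmat, Matrix.smul_mul, Matrix.fromBlocks_multiply, Matrix.fromBlocks_smul,
    ← Matrix.fromBlocks_one]
  congr 1 <;> ext i j <;> simp [Matrix.one_apply] <;> split_ifs <;> norm_num

theorem isUnit_det_Cmat : IsUnit (Cmat p q).det :=
  Matrix.isUnit_det_of_right_inverse Cmat_mul_Dmat

theorem Cmat_inv : (Cmat p q)⁻¹ = Dmat p q :=
  Matrix.inv_eq_right_inv Cmat_mul_Dmat

theorem Om_mul_hess (ψ : OrthonormalBasis (Fin (p + q)) ℂ V)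
    (H : ⋀[ℂ]^p V →ₗ[ℂ] ⋀[ℂ]^p V) : -(Om p q * hess ψ H) = Matrix.fromBlocks
      (-(HCIS ψ H - Delta ψ H).map Complex.im)
      (-((HCIS ψ H - Delta ψ H).map Complex.re - E0 ψ H • (1 : Matrix _ _ ℝ)))
      ((HCIS ψ H + Delta ψ H).map Complex.re - E0 ψ H • (1 : Matrix _ _ ℝ))
      (-(HCIS ψ H + Delta ψ H).map Complex.im) := by
  rw [Om, hess, Matrix.fromBlocks_multiply, Matrix.fromBlocks_neg]
  simp

theorem Cmat_conj_hess (ψ : OrthonormalBasis (Fin (p + q)) ℂ V)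
    (H : ⋀[ℂ]^p V →ₗ[ℂ] ⋀[ℂ]^p V) :
    (Cmat p q)⁻¹ * (-(Om p q * hess ψ H)).map Complex.ofReal * Cmat p q = schr ψ H := by
  rw [Cmat_inv, Om_mul_hess, Dmat, Cmat, schr, Matrix.fromBlocks_map, Matrix.mul_smul,
    Matrix.fromBlocks_multiply, Matrix.fromBlocks_multiply, Matrix.fromBlocks_smul,
    Matrix.fromBlocks_smul]
  simp only [Matrix.one_mul, Matrix.mul_one, Matrix.smul_mul, Matrix.mul_smul, Matrix.neg_mul,
    Matrix.mul_neg]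
  congr 1 <;> ext j j' <;> apply Complex.ext <;>
    rcases eq_or_ne j j' with rfl | h <;> simp [*] <;> ring

theorem zzbar_eq (w : Param p q) : zzbar w = Dmat p q *ᵥ fun i => (w i : ℂ) := by
  funext i
  rcases i with j | j <;>
    simp [zzbar, zCoord, Dmat, Matrix.mulVec, dotProduct, Fintype.sum_sum_type, Matrix.one_apply]

theorem zzbar_mulVec (ψ : OrthonormalBasis (Fin (p + q)) ℂ V)
    (H : ⋀[ℂ]^p V →ₗ[ℂ] ⋀[ℂ]^p V) (w : Param p q) :
    zzbar (-(Om p q * hess ψ H) *ᵥ w) = schr ψ H *ᵥ zzbar w := by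
  have h : (fun i => (((-(Om p q * hess ψ H)) *ᵥ w) i : ℂ))
      = (-(Om p q * hess ψ H)).map Complex.ofReal *ᵥ fun i => (w i : ℂ) :=
    funext fun i => RingHom.map_mulVec Complex.ofRealHom _ w i
  rw [zzbar_eq, zzbar_eq, ← Cmat_conj_hess, Cmat_inv, h, Matrix.mulVec_mulVec,
    Matrix.mulVec_mulVec, Matrix.mul_assoc _ (Cmat p q), Cmat_mul_Dmat, Matrix.mul_one]

theorem hasDerivAt_zzbar_iff (w : ℝ → Param p q) (v : Param p q) (t : ℝ) :
    HasDerivAt w v t ↔ HasDerivAt (fun τ => zzbar (w τ)) (zzbar v) t := by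
  constructor
  · intro h
    have hi := hasDerivAt_pi.mp h
    have hz : ∀ j, HasDerivAt (fun τ => zCoord (w τ) j) (zCoord v j) t := fun j =>
      (hi (Sum.inl j)).ofReal_comp.add ((hi (Sum.inr j)).ofReal_comp.const_mul Complex.I)
    refine hasDerivAt_pi.mpr fun i => ?_
    rcases i with j | j
    · exact hz j
    · exact Complex.conjCLE.hasFDerivAt.comp_hasDerivAt t (hz j)
  · intro h
    have hz : ∀ j, HasDerivAt (fun τ => zCoord (w τ) j) (zCoord v j) t :=
      fun j => hasDerivAt_pi.mp h (Sum.inl j)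
    refine hasDerivAt_pi.mpr fun i => ?_
    rcases i with j | j
    · have := Complex.reCLM.hasFDerivAt.comp_hasDerivAt t (hz j)
      simpa [Function.comp_def, zCoord] using this
    · have := Complex.imCLM.hasFDerivAt.comp_hasDerivAt t (hz j)
      simpa [Function.comp_def, zCoord] using this

theorem hasDerivAt_schr_iff (ψ : OrthonormalBasis (Fin (p + q)) ℂ V)
    (H : ⋀[ℂ]^p V →ₗ[ℂ] ⋀[ℂ]^p V) (w : ℝ → Param p q) (t : ℝ) :
    HasDerivAt w (-(Om p q * hess ψ H) *ᵥ w t) t ↔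
      HasDerivAt (fun τ => zzbar (w τ)) (schr ψ H *ᵥ zzbar (w t)) t := by
  rw [hasDerivAt_zzbar_iff, zzbar_mulVec]

/-- The complexification of the coordinate basis of the parameter space. -/
def coordBasisC (p q : ℕ) : Module.Basis (Idx p q) ℂ (ℂ ⊗[ℝ] Param p q) :=
  Algebra.TensorProduct.basis ℂ (Pi.basisFun ℝ (Idx p q))

/-- The basis of the complexified parameter space with transition matrix `Cmat`. -/
def upsilonBasis (p q : ℕ) : Module.Basis (Idx p q) ℂ (ℂ ⊗[ℝ] Param p q) :=
  (coordBasisC p q).map (Matrix.toLinearEquiv (coordBasisC p q) (Cmat p q) isUnit_det_Cmat)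

theorem upsilonBasis_eq_sum (j : Idx p q) :
    upsilonBasis p q j = ∑ i, Cmat p q i j • coordBasisC p q i := by
  simp only [upsilonBasis, Module.Basis.map_apply, Matrix.toLinearEquiv_apply, Matrix.toLin_self]

theorem upsilonBasis_apply (j : Idx p q) : upsilonBasis p q j = upsilon p q j := by
  rw [upsilonBasis_eq_sum]
  rcases j with j | j <;>
    simp [Fintype.sum_sum_type, Cmat, coordBasisC, upsilon, Matrix.one_apply, smul_smul,
      sub_eq_add_neg]

theorem toMatrix_upsilonBasis :
    (coordBasisC p q).toMatrix (upsilonBasis p q) = Cmat p q := by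
  ext i j
  rw [Module.Basis.toMatrix_apply, upsilonBasis_eq_sum, Module.Basis.repr_sum_self]

theorem upsilonBasis_toMatrix :
    (upsilonBasis p q).toMatrix (coordBasisC p q) = Dmat p q := by
  have h := (upsilonBasis p q).toMatrix_mul_toMatrix_flip (coordBasisC p q)
  rw [toMatrix_upsilonBasis] at h
  exact left_inv_eq_right_inv h Cmat_mul_Dmat

theorem upsilonBasis_repr (w : Param p q) :
    ⇑((upsilonBasis p q).repr ((1 : ℂ) ⊗ₜ[ℝ] w)) = zzbar w := by
  have h : ⇑((coordBasisC p q).repr ((1 : ℂ) ⊗ₜ[ℝ] w)) = fun i => (w i : ℂ) := by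
    funext i
    simp [coordBasisC, Algebra.TensorProduct.basis_repr_tmul]
  rw [zzbar_eq, ← upsilonBasis_toMatrix, ← h, Module.Basis.toMatrix_mulVec_repr]

theorem toMatrix_upsilonBasis_baseChange (M : Matrix (Idx p q) (Idx p q) ℝ) :
    LinearMap.toMatrix (upsilonBasis p q) (upsilonBasis p q) ((Matrix.mulVecLin M).baseChange ℂ)
      = (Cmat p q)⁻¹ * M.map Complex.ofReal * Cmat p q := by
  have h : LinearMap.toMatrix (coordBasisC p q) (coordBasisC p q)
      ((Matrix.mulVecLin M).baseChange ℂ) = M.map Complex.ofReal := by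
    rw [coordBasisC, LinearMap.toMatrix_baseChange, ← Matrix.toLin'_apply',
      LinearMap.toMatrix_eq_toMatrix', LinearMap.toMatrix'_toLin']
    rfl
  rw [← basis_toMatrix_mul_linearMap_toMatrix_mul_basis_toMatrix (upsilonBasis p q)
    (coordBasisC p q) (upsilonBasis p q) (coordBasisC p q), h, toMatrix_upsilonBasis,
    upsilonBasis_toMatrix, Cmat_inv]

/-! ### The TDHF equations -/

/-- Matrix elements of the electronic Hamiltonian between singly excited determinants for canonical
orbitals. -/
theorem HCIS_elecHam_canonical (ψ : OrthonormalBasis (Fin (p + q)) ℂ V) {h : V →ₗ[ℂ] V}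
    {g : V ⊗[ℂ] V →ₗ[ℂ] V ⊗[ℂ] V} (hh : h.IsSymmetric) (hg : g.IsSymmetric)
    (hgc : g ∘ₗ (TensorProduct.comm ℂ V V).toLinearMap
      = (TensorProduct.comm ℂ V V).toLinearMap ∘ₗ g) {ε : Fin (p + q) → ℝ}
    (hε : fockMat ψ h g = Matrix.diagonal fun i => (ε i : ℂ)) (ν ν' : Fin q) (μ μ' : Fin p) :
    HCIS ψ (elecHam ψ h g) (ν, μ) (ν', μ')
      = (if μ = μ' ∧ ν = ν' then
          ((E0 ψ (elecHam ψ h g) + ε (Fin.natAdd p ν) - ε (Fin.castAdd q μ) : ℝ) : ℂ) else 0)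
        + antiInt ψ g (Fin.natAdd p ν) (Fin.castAdd q μ')
            (Fin.castAdd q μ) (Fin.natAdd p ν') := by
  rw [HCIS_elecHam ψ h hgc, hε, ← E0_eq ψ (elecHam_isHermitianOp ψ hh hg hgc)]
  congr 1
  simp only [Matrix.diagonal_apply, Prod.mk.injEq, (Fin.castAdd_injective p q).eq_iff,
    (Fin.natAdd_injective q p).eq_iff]
  by_cases h1 : ν = ν' <;> by_cases h2 : μ = μ' <;> simp [h1, h2, eq_comm (a := μ')]

theorem hasDerivAt_tdhf_iff (ψ : OrthonormalBasis (Fin (p + q)) ℂ V) {h : V →ₗ[ℂ] V}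
    {g : V ⊗[ℂ] V →ₗ[ℂ] V ⊗[ℂ] V} (hh : h.IsSymmetric) (hg : g.IsSymmetric)
    (hgc : g ∘ₗ (TensorProduct.comm ℂ V V).toLinearMap
      = (TensorProduct.comm ℂ V V).toLinearMap ∘ₗ g) {ε : Fin (p + q) → ℝ}
    (hε : fockMat ψ h g = Matrix.diagonal fun i => (ε i : ℂ)) (w : ℝ → Param p q) (t : ℝ) :
    HasDerivAt w (-(Om p q * hess ψ (elecHam ψ h g)) *ᵥ w t) t ↔
      ∀ (ν : Fin q) (μ : Fin p),
        HasDerivAt (fun τ => zCoord (w τ) (ν, μ))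
          (Complex.I * ∑ ν' : Fin q, ∑ μ' : Fin p,
              (antiInt ψ g (Fin.natAdd p ν) (Fin.castAdd q μ')
                  (Fin.castAdd q μ) (Fin.natAdd p ν')
                + (if ν = ν' ∧ μ = μ' then
                    ((ε (Fin.natAdd p ν) - ε (Fin.castAdd q μ) : ℝ) : ℂ) else 0))
                * zCoord (w t) (ν', μ')
            + Complex.I * ∑ ν' : Fin q, ∑ μ' : Fin p,
              antiInt ψ g (Fin.natAdd p ν) (Fin.natAdd p ν')
                  (Fin.castAdd q μ) (Fin.castAdd q μ')
                * starRingEnd ℂ (zCoord (w t) (ν', μ'))) t ∧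
        HasDerivAt (fun τ => starRingEnd ℂ (zCoord (w τ) (ν, μ)))
          (-(Complex.I * ∑ ν' : Fin q, ∑ μ' : Fin p,
              (antiInt ψ g (Fin.castAdd q μ) (Fin.natAdd p ν')
                  (Fin.natAdd p ν) (Fin.castAdd q μ')
                + (if ν = ν' ∧ μ = μ' then
                    ((ε (Fin.natAdd p ν) - ε (Fin.castAdd q μ) : ℝ) : ℂ) else 0))
                * starRingEnd ℂ (zCoord (w t) (ν', μ')))
            - Complex.I * ∑ ν' : Fin q, ∑ μ' : Fin p,
              antiInt ψ g (Fin.castAdd q μ) (Fin.castAdd q μ')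
                  (Fin.natAdd p ν) (Fin.natAdd p ν')
                * zCoord (w t) (ν', μ')) t := by
  have hA : ∀ ν ν' μ μ', HCIS ψ (elecHam ψ h g) (ν, μ) (ν', μ')
        - (if (ν, μ) = (ν', μ') then (E0 ψ (elecHam ψ h g) : ℂ) else 0)
      = antiInt ψ g (Fin.natAdd p ν) (Fin.castAdd q μ') (Fin.castAdd q μ) (Fin.natAdd p ν')
        + (if ν = ν' ∧ μ = μ' then
            ((ε (Fin.natAdd p ν) - ε (Fin.castAdd q μ) : ℝ) : ℂ) else 0) := by
    intro ν ν' μ μ'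
    rw [HCIS_elecHam_canonical ψ hh hg hgc hε]
    simp only [Prod.mk.injEq, and_comm (a := μ = μ')]
    split_ifs
    · push_cast
      ring
    · ring
  have hA' : ∀ ν ν' μ μ', starRingEnd ℂ (HCIS ψ (elecHam ψ h g) (ν, μ) (ν', μ'))
        - (if (ν, μ) = (ν', μ') then (E0 ψ (elecHam ψ h g) : ℂ) else 0)
      = antiInt ψ g (Fin.castAdd q μ) (Fin.natAdd p ν') (Fin.natAdd p ν) (Fin.castAdd q μ')
        + (if ν = ν' ∧ μ = μ' then
            ((ε (Fin.natAdd p ν) - ε (Fin.castAdd q μ) : ℝ) : ℂ) else 0) := by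
    intro ν ν' μ μ'
    have h1 := congrArg (starRingEnd ℂ) (hA ν ν' μ μ')
    simpa only [map_sub, map_add, apply_ite (starRingEnd ℂ), Complex.conj_ofReal, map_zero,
      antiInt_conj ψ hg hgc] using h1
  have hD : ∀ ν ν' μ μ', starRingEnd ℂ (Delta ψ (elecHam ψ h g) (ν, μ) (ν', μ'))
      = antiInt ψ g (Fin.natAdd p ν) (Fin.natAdd p ν') (Fin.castAdd q μ) (Fin.castAdd q μ') := by
    intro ν ν' μ μ'
    rw [Delta_elecHam ψ h hgc, antiInt_conj ψ hg hgc]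
  rw [hasDerivAt_schr_iff, hasDerivAt_pi, Sum.forall, Prod.forall, Prod.forall, ← forall_and]
  refine forall_congr' fun ν => ?_
  rw [← forall_and]
  refine forall_congr' fun μ => and_congr (Iff.of_eq ?_) (Iff.of_eq ?_)
  · congr 1
    rw [schr, Matrix.smul_mulVec, Pi.smul_apply, smul_eq_mul]
    simp only [smul_eq_mul, Matrix.mulVec, dotProduct,
      Fintype.sum_sum_type, Matrix.fromBlocks_apply₁₁, Matrix.fromBlocks_apply₁₂, zzbar,
      Sum.elim_inl, Sum.elim_inr, Fintype.sum_prod_type, Matrix.sub_apply, Matrix.smul_apply,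
      Matrix.one_apply, Matrix.map_apply, mul_ite, mul_one, mul_zero, hA, hD]
    rw [mul_add]
  · congr 1
    rw [schr, Matrix.smul_mulVec, Pi.smul_apply, smul_eq_mul]
    simp only [smul_eq_mul, Matrix.mulVec, dotProduct,
      Fintype.sum_sum_type, Matrix.fromBlocks_apply₂₁, Matrix.fromBlocks_apply₂₂, zzbar,
      Sum.elim_inl, Sum.elim_inr, Fintype.sum_prod_type, Matrix.sub_apply, Matrix.smul_apply,
      Matrix.neg_apply, Matrix.one_apply, Matrix.map_apply, mul_ite, mul_one, mul_zero, hA',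
      Delta_elecHam ψ h hgc, neg_mul, Finset.sum_neg_distrib]
    ring

end

end HFManifold

theorem mainTheorem2 {p q : ℕ} {V : Type*} [NormedAddCommGroup V] [InnerProductSpace ℂ V]
    (ψ : OrthonormalBasis (Fin (p + q)) ℂ V) :
    -- the parametrization takes values in unit vectors spanning lines of the HF manifold
    (gammaU ψ 0 = Phi0 ψ ∧
      ∀ w : Param p q, pInner ψ (gammaU ψ w) (gammaU ψ w) = 1 ∧
        ∃ hne : gammaU ψ w ≠ 0, Projectivization.mk ℂ (gammaU ψ w) hne ∈ HF p V ∧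
          ∀ H : ⋀[ℂ]^p V →ₗ[ℂ] ⋀[ℂ]^p V,
            energy ψ H w = projEnergy ψ H (Projectivization.mk ℂ (gammaU ψ w) hne)) ∧
    -- arbitrary Hermitian operator
    (∀ H : ⋀[ℂ]^p V →ₗ[ℂ] ⋀[ℂ]^p V, IsHermitianOp ψ H →
      (∀ w : Param p q,
        (energy ψ H w : ℂ) = (1 / 2) * pInner ψ (gammaU ψ w) (H (gammaU ψ w))) ∧
      ContDiff ℝ ∞ (energy ψ H) ∧
      -- stationarity at the origin and Brillouin conditions
      (fderiv ℝ (energy ψ H) 0 = 0 ↔ Brillouin ψ H) ∧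
      -- the Hessian at the origin
      (HCIS ψ H).IsHermitian ∧ (Delta ψ H).IsSymm ∧
      (∀ u v : Param p q,
        fderiv ℝ (fderiv ℝ (energy ψ H)) 0 u v = u ⬝ᵥ (hess ψ H *ᵥ v)) ∧
      -- the Hamiltonian equations and their linearization at the origin
      (∀ u v : Param p q, omega u v = u ⬝ᵥ (Om p q *ᵥ v)) ∧
      (∃! ξ : Param p q → Param p q, IsSymplecticGradient (energy ψ H) ξ) ∧
      (∀ ξ : Param p q → Param p q, IsSymplecticGradient (energy ψ H) ξ →
        (ξ 0 = 0 ↔ Brillouin ψ H) ∧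
        HasFDerivAt ξ
          (LinearMap.toContinuousLinearMap (Matrix.mulVecLin (-(Om p q * hess ψ H)))) 0) ∧
      -- the Schrödinger-type form of the linearized equations on the complexification
      IsUnit (Cmat p q).det ∧
      (Cmat p q)⁻¹ * (-(Om p q * hess ψ H)).map Complex.ofReal * Cmat p q = schr ψ H ∧
      (∃ B : Module.Basis (Idx p q) ℂ (ℂ ⊗[ℝ] Param p q),
        (∀ j, B j = upsilon p q j) ∧
        (∀ w : Param p q, ⇑(B.repr ((1 : ℂ) ⊗ₜ[ℝ] w)) = zzbar w) ∧
        LinearMap.toMatrix B B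
          ((Matrix.mulVecLin (-(Om p q * hess ψ H))).baseChange ℂ) = schr ψ H) ∧
      (∀ (w : ℝ → Param p q) (t : ℝ),
        HasDerivAt w (-(Om p q * hess ψ H) *ᵥ w t) t ↔
          HasDerivAt (fun τ => zzbar (w τ)) (schr ψ H *ᵥ zzbar (w t)) t)) ∧
    -- the electronic Hamiltonian and the TDHF equations
    (∀ (h : V →ₗ[ℂ] V) (g : V ⊗[ℂ] V →ₗ[ℂ] V ⊗[ℂ] V),
      h.IsSymmetric → g.IsSymmetric →
      g ∘ₗ (TensorProduct.comm ℂ V V).toLinearMap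
        = (TensorProduct.comm ℂ V V).toLinearMap ∘ₗ g →
      IsHermitianOp ψ (elecHam ψ h g) ∧
      ∀ ε : Fin (p + q) → ℝ, fockMat ψ h g = Matrix.diagonal (fun i => (ε i : ℂ)) →
        (∀ (ν ν' : Fin q) (μ μ' : Fin p),
          HCIS ψ (elecHam ψ h g) (ν, μ) (ν', μ')
            = (if μ = μ' ∧ ν = ν' then
                ((E0 ψ (elecHam ψ h g) + ε (Fin.natAdd p ν) - ε (Fin.castAdd q μ) : ℝ) : ℂ)
                else 0)
              + antiInt ψ g (Fin.natAdd p ν) (Fin.castAdd q μ')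
                  (Fin.castAdd q μ) (Fin.natAdd p ν') ∧
          Delta ψ (elecHam ψ h g) (ν, μ) (ν', μ')
            = antiInt ψ g (Fin.castAdd q μ) (Fin.castAdd q μ')
                (Fin.natAdd p ν) (Fin.natAdd p ν')) ∧
        ∀ (w : ℝ → Param p q) (t : ℝ),
          HasDerivAt w (-(Om p q * hess ψ (elecHam ψ h g)) *ᵥ w t) t ↔
            ∀ (ν : Fin q) (μ : Fin p),
              HasDerivAt (fun τ => zCoord (w τ) (ν, μ))
                (Complex.I * ∑ ν' : Fin q, ∑ μ' : Fin p,
                    (antiInt ψ g (Fin.natAdd p ν) (Fin.castAdd q μ')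
                        (Fin.castAdd q μ) (Fin.natAdd p ν')
                      + (if ν = ν' ∧ μ = μ' then
                          ((ε (Fin.natAdd p ν) - ε (Fin.castAdd q μ) : ℝ) : ℂ) else 0))
                      * zCoord (w t) (ν', μ')
                  + Complex.I * ∑ ν' : Fin q, ∑ μ' : Fin p,
                    antiInt ψ g (Fin.natAdd p ν) (Fin.natAdd p ν')
                        (Fin.castAdd q μ) (Fin.castAdd q μ')
                      * starRingEnd ℂ (zCoord (w t) (ν', μ'))) t ∧
              HasDerivAt (fun τ => starRingEnd ℂ (zCoord (w τ) (ν, μ)))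
                (-(Complex.I * ∑ ν' : Fin q, ∑ μ' : Fin p,
                    (antiInt ψ g (Fin.castAdd q μ) (Fin.natAdd p ν')
                        (Fin.natAdd p ν) (Fin.castAdd q μ')
                      + (if ν = ν' ∧ μ = μ' then
                          ((ε (Fin.natAdd p ν) - ε (Fin.castAdd q μ) : ℝ) : ℂ) else 0))
                      * starRingEnd ℂ (zCoord (w t) (ν', μ')))
                  - Complex.I * ∑ ν' : Fin q, ∑ μ' : Fin p,
                    antiInt ψ g (Fin.castAdd q μ) (Fin.castAdd q μ')
                        (Fin.natAdd p ν) (Fin.natAdd p ν')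
                      * zCoord (w t) (ν', μ')) t) := by
  refine ⟨⟨gammaU_zero ψ, fun w => ⟨pInner_gammaU ψ w, gammaU_ne_zero ψ w,
    mk_gammaU_mem_HF ψ w _, energy_eq_projEnergy ψ w _⟩⟩, fun H hH => ?_, fun h g hh hg hgc => ?_⟩
  · refine ⟨fun w => ?_, contDiff_energy ψ H, fderiv_energy_eq_zero_iff ψ hH,
      HCIS_isHermitian ψ hH, Delta_isSymm ψ H, fderiv_fderiv_energy ψ hH, omega_eq, ?_,
      fun ξ hξ => ⟨?_, hasFDerivAt_symplecticGradient ψ hH hξ⟩, isUnit_det_Cmat,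
      Cmat_conj_hess ψ H, ⟨upsilonBasis p q, upsilonBasis_apply, upsilonBasis_repr, ?_⟩,
      hasDerivAt_schr_iff ψ H⟩
    · have hre : starRingEnd ℂ (pInner ψ (gammaU ψ w) (H (gammaU ψ w)))
          = pInner ψ (gammaU ψ w) (H (gammaU ψ w)) := by rw [pInner_conj, hH]
      rw [energy, Complex.ofReal_mul, Complex.conj_eq_iff_re.mp hre]
      norm_num
    · simp only [isSymplecticGradient_iff]
      exact existsUnique_eq
    · rw [symplecticGradient_zero_iff hξ, fderiv_energy_eq_zero_iff ψ hH]
    · rw [toMatrix_upsilonBasis_baseChange, Cmat_conj_hess]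
  · exact ⟨elecHam_isHermitianOp ψ hh hg hgc, fun ε hε =>
      ⟨fun ν ν' μ μ' => ⟨HCIS_elecHam_canonical ψ hh hg hgc hε ν ν' μ μ',
        Delta_elecHam ψ h hgc (ν, μ) (ν', μ')⟩, hasDerivAt_tdhf_iff ψ hh hg hgc hε⟩⟩
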